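/- Let $d\ge 2$ and $\eta_E>0$. The Gaussian Unitary Ensemble (GUE) of $d\times d$ Hermitian matrices with scale factor $\eta_E$ is the law of $B=U\,\mathrm{diag}(\lambda_1,\dots,\lambda_d)\,U^\dagger$, where $U$ is Haar distributed on the unitary group $U(d)$ and, independently of $U$, $\boldsymbol\lambda=(\lambda_1,\dots,\lambda_d)\in\mathbb R^d$ has the density $$P_{gue}(\boldsymbol\lambda)=\frac1Z\,e^{-\frac{\eta_E}{2}\sum_i\lambda_i^2}\prod_{i<j}(\lambda_i-\lambda_j)^2$$ with respect to Lebesgue measure, $Z$ being the normalization constant. Let $\rho_0$ be a $d\times d$ density matrix (positive semidefinite with trace $1$) and let $a,a',t\in\mathbb R$. Put $S_{lin}(\rho_0)=1-\mathrm{tr}\,\rho_0^2$ and $\rho_a(t)=e^{-iaBt}\rho_0e^{iaBt}$, and define the decoherence factor and the super-fidelity factor $$\Gamma_{aa'}(t)=\left|\mathrm{tr}\!\left(e^{-i(a-a')Bt}\rho_0\right)\right|^2,\qquad G_{aa'}(t)=\mathrm{tr}\big(\rho_a(t)\rho_{a'}(t)\big)+\sqrt{\big(1-\mathrm{tr}\,\rho_a(t)^2\big)\big(1-\mathrm{tr}\,\rho_{a'}(t)^2\big)}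 .$$ Let $f_t(\boldsymbol\lambda)=\sum_{m}\sum_{n>m}\cos\left[(a-a')(\lambda_n-\lambda_m)t\right]$. Write $\langle\Gamma_{aa'}(t)\rangle$ and $\langle G_{aa'}(t)\rangle$ for the averages over the GUE matrix $B$ with $\rho_0,a,a',t$ fixed, and $\langle f_t\rangle=\int f_t(\boldsymbol\lambda)P_{gue}(\boldsymbol\lambda)\,d\boldsymbol\lambda$. Then all three averages exist (the functions are integrable) and $$\langle\Gamma_{aa'}(t)\rangle=\frac{1+\mathrm{tr}\,\rho_0^2}{d+1}+\langle f_t\rangle\,\frac{2\,(d-\mathrm{tr}\,\rho_0^2)}{d(d^2-1)},$$ $$\langle G_{aa'}(t)\rangle=S_{lin}(\rho_0)+\frac{1+\mathrm{tr}\,\rho_0^2}{d+1}+\langle f_t\rangle\,\frac{2\,(d\,\mathrm{tr}\,\rho_0^2-1)}{d(d^2-1)},$$ $$\langle f_t\rangle=p(d,\tilde\Delta_t)\,e^{-\tilde\Delta_t^2},\qquad \tilde\Delta_t=\frac{(a-a')t}{\sqrt{\eta_E}},$$ where $$p(d,\Delta)=\sum_{n=0}^{d-2}\ \sum_{m=n+1}^{d-1}\left[L_n^{(0)}(\Delta^2)\,L_m^{(0)}(\Delta^2)-\frac{n!}{m!}\,\Delta^{2(m-n)}\big(L_n^{(m-n)}(\Delta^2)\big)^2\right]$$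 and $L_n^{(m)}(x)=\sum_{k=0}^n\binom{n+m}{n-k}\frac{(-x)^k}{k!}$ are the associated Laguerre polynomials. -/

import Mathlib

namespace VonNeumannGUE

noncomputable section

open MeasureTheory

/-! ### Quantum states and the factors attached to a single apparatus -/

open scoped ComplexOrder in
/-- Density matrices (quantum states) of a `d`-dimensional apparatus. -/
structure IsDensityMatrix {d : ℕ} (ρ : Matrix (Fin d) (Fin d) ℂ) : Prop where
  posSemidef : ρ.PosSemidef
  trace_eq_one : ρ.trace = 1

/-- The purity `tr ρ²`, as a real number. -/
def purity {d : ℕ} (ρ : Matrix (Fin d) (Fin d) ℂ) : ℝ :=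
  (ρ * ρ).trace.re

/-- The linear entropy `S_lin(ρ) = 1 - tr ρ²`. -/
def linearEntropy {d : ℕ} (ρ : Matrix (Fin d) (Fin d) ℂ) : ℝ :=
  1 - purity ρ

/-- The conditional apparatus state `ρ_a(t) = e^{-iaBt} ρ₀ e^{iaBt}`. -/
def evolvedState {d : ℕ} (B ρ₀ : Matrix (Fin d) (Fin d) ℂ) (a t : ℝ) :
    Matrix (Fin d) (Fin d) ℂ :=
  NormedSpace.exp ((-(Complex.I * ((a * t : ℝ) : ℂ))) • B) * ρ₀ *
    NormedSpace.exp ((Complex.I * ((a * t : ℝ) : ℂ)) • B)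

/-- The single-apparatus decoherence factor `Γ_{aa'}(t) = |tr(e^{-i(a-a')Bt} ρ₀)|²`. -/
def decoherenceFactor {d : ℕ} (B ρ₀ : Matrix (Fin d) (Fin d) ℂ) (a a' t : ℝ) : ℝ :=
  ‖(NormedSpace.exp ((-(Complex.I * (((a - a') * t : ℝ) : ℂ))) • B) * ρ₀).trace‖ ^ 2

/-- The super-fidelity `G(ρ, σ) = tr(ρσ) + √((1 - tr ρ²)(1 - tr σ²))` of two states. -/
def superFidelity {d : ℕ} (ρ σ : Matrix (Fin d) (Fin d) ℂ) : ℝ :=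
  (ρ * σ).trace.re + Real.sqrt ((1 - purity ρ) * (1 - purity σ))

/-- The single-apparatus super-fidelity factor `G_{aa'}(t) = G(ρ_a(t), ρ_{a'}(t))`. -/
def superFidelityFactor {d : ℕ} (B ρ₀ : Matrix (Fin d) (Fin d) ℂ) (a a' t : ℝ) : ℝ :=
  superFidelity (evolvedState B ρ₀ a t) (evolvedState B ρ₀ a' t)

/-! ### The Gaussian Unitary Ensemble -/

/-- The entrywise (product) σ-algebra on complex matrices, which is the Borel one. -/
instance instMeasurableSpaceMatrix (d : ℕ) : MeasurableSpace (Matrix (Fin d) (Fin d) ℂ) :=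
  inferInstanceAs (MeasurableSpace (Fin d → Fin d → ℂ))

instance instBorelSpaceMatrix (d : ℕ) : BorelSpace (Matrix (Fin d) (Fin d) ℂ) :=
  inferInstanceAs (BorelSpace (Fin d → Fin d → ℂ))

instance instCompactSpaceUnitaryGroup (d : ℕ) : CompactSpace (Matrix.unitaryGroup (Fin d) ℂ) := by
  refine isCompact_iff_compactSpace.mp ?_
  have hK : IsCompact (Set.univ.pi fun _ : Fin d => Set.univ.pi fun _ : Fin d =>
      Metric.closedBall (0 : ℂ) 1) :=
    isCompact_univ_pi fun _ => isCompact_univ_pi fun _ => isCompact_closedBall 0 1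
  refine IsCompact.of_isClosed_subset (X := Matrix (Fin d) (Fin d) ℂ) hK ?_ ?_
  · have : (Matrix.unitaryGroup (Fin d) ℂ : Set (Matrix (Fin d) (Fin d) ℂ))
        = {U | U * star U = 1} := by
      ext U
      exact Matrix.mem_unitaryGroup_iff
    rw [this]
    exact isClosed_eq (continuous_id.mul continuous_star) continuous_const
  · intro U hU i _ j _
    simpa using entry_norm_bound_of_unitary hU i j

/-- The Haar probability measure on the unitary group `U(d)`. -/
def haarUnitary (d : ℕ) : Measure (Matrix.unitaryGroup (Fin d) ℂ) :=
  Measure.haarMeasure ⊤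

/-- The unnormalised GUE eigenvalue density
`e^{-(η/2) ∑ᵢ λᵢ²} ∏_{i<j} (λᵢ - λⱼ)²`. -/
def gueWeight (d : ℕ) (η : ℝ) (l : Fin d → ℝ) : ℝ :=
  Real.exp (-(η / 2) * ∑ i, l i ^ 2) * ∏ i, ∏ j ∈ Finset.Ioi i, (l i - l j) ^ 2

/-- The GUE partition function `Z`. -/
def guePartition (d : ℕ) (η : ℝ) : ENNReal :=
  ∫⁻ l : Fin d → ℝ, ENNReal.ofReal (gueWeight d η l)

/-- The GUE eigenvalue distribution `P_gue(λ) dλ`, with `P_gue = Z⁻¹ · gueWeight`. -/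
def gueEigenvalues (d : ℕ) (η : ℝ) : Measure (Fin d → ℝ) :=
  (guePartition d η)⁻¹ •
    (volume : Measure (Fin d → ℝ)).withDensity fun l => ENNReal.ofReal (gueWeight d η l)

/-- The Hermitian matrix `U diag(λ) U†`. -/
def conjDiagonal {d : ℕ} (x : (Fin d → ℝ) × Matrix.unitaryGroup (Fin d) ℂ) :
    Matrix (Fin d) (Fin d) ℂ :=
  (x.2 : Matrix (Fin d) (Fin d) ℂ) * Matrix.diagonal (fun i => (x.1 i : ℂ)) *
    (x.2 : Matrix (Fin d) (Fin d) ℂ).conjTranspose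

/-- The GUE measure with scale factor `η`,
`dμ(H) = Z⁻¹ e^{-(η/2) ∑ᵢ λᵢ²} ∏_{i<j} (λᵢ - λⱼ)² dλ dU` for `H = U diag(λ) U†`:
the law of `U diag(λ) U†` with `λ` distributed according to the eigenvalue distribution and `U`
independently according to the Haar measure. -/
def gueMeasure (d : ℕ) (η : ℝ) : Measure (Matrix (Fin d) (Fin d) ℂ) :=
  ((gueEigenvalues d η).prod (haarUnitary d)).map conjDiagonal

/-! ### The closed form -/

/-- `f_t(a, λ) = ∑_m ∑_{n>m} cos((a - a')(λ_n - λ_m) t)`. -/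
def cosineSum {d : ℕ} (a a' t : ℝ) (l : Fin d → ℝ) : ℝ :=
  ∑ m, ∑ n ∈ Finset.Ioi m, Real.cos ((a - a') * (l n - l m) * t)

/-- The associated Laguerre polynomial
`L_n^{(m)}(x) = ∑_{k=0}^n binom(n+m, n-k) (-x)^k / k!`. -/
def laguerre (n m : ℕ) (x : ℝ) : ℝ :=
  ∑ k ∈ Finset.range (n + 1), ((n + m).choose (n - k) : ℝ) * (-x) ^ k / (k.factorial : ℝ)

/-- The polynomial
`p(d, Δ) = ∑_{0 ≤ n < m ≤ d-1} [L_n(Δ²) L_m(Δ²) - (n!/m!) Δ^{2(m-n)} (L_n^{(m-n)}(Δ²))²]`. -/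
def guePolynomial (d : ℕ) (Δ : ℝ) : ℝ :=
  ∑ n ∈ Finset.range d, ∑ m ∈ Finset.Ioo n d,
    (laguerre n 0 (Δ ^ 2) * laguerre m 0 (Δ ^ 2) -
      (n.factorial : ℝ) / (m.factorial : ℝ) * Δ ^ (2 * (m - n)) *
        laguerre n (m - n) (Δ ^ 2) ^ 2)

end

end VonNeumannGUE

/-! Write B = U diag(λ) U†. In the eigenbasis of B the initial state becomes R = U†ρ₀U, and the
evolution only multiplies R_mn by a phase. Hence Γ is the double sum of cos((a-a')(λ_n-λ_m)t) R_mm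
R_nn, and tr(ρ_a ρ_a') is the same sum with |R_mn|² in place of R_mm R_nn. Purity is conserved, so
the square root in G is the constant S_lin(ρ₀). As λ and U are independent, every term averages to a
product of an eigenvalue average and a Haar average (`integral_sum_cos_mul_permCovariant`).

Haar side: invariance under permutation matrices leaves three unknowns, α = ⟨R_pp²⟩, β = ⟨R_pp R_qq⟩
and γ = ⟨|R_pq|²⟩ with p ≠ q. The values of tr R and tr R² give two linear equations. The third, α =
β + γ, comes from unitaries mixing two coordinates (`integral_diagProduct_diag_eq`);
`haarUnitary_second_moments` solves the system.

Eigenvalue side: the Vandermonde determinant is also a determinant of Hermite polynomials. Expanding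
its square over permutations reduces everything to integrals of He_n He_m e^{isx} against a
Gaussian, which are Laguerre polynomials (`gaussFourier_hermiteℂ_mul_hermiteℂ`). For
e^{ic(λ_p-λ_q)}, orthogonality in the other variables leaves only the identity and the transposition
of p and q (`integral_gueWeight_mul_exp_sub`): these are the two terms of p(d,Δ). A rescaling by √η
reduces to η = 1. -/

namespace VonNeumannGUE

noncomputable section

open MeasureTheory

/-! ### Gaussian Fourier integrals of Hermite polynomials -/

section Hermite

open Polynomial

/-- The Gaussian weight `e^{isx - x²/2}`. -/
def gaussKernel (s x : ℝ) : ℂ :=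
  Complex.exp (Complex.I * s * x - x ^ 2 / 2)

/-- The Gaussian Fourier integral `∫ P(x) e^{isx - x²/2} dx` of a polynomial. -/
def gaussFourier (s : ℝ) (P : ℂ[X]) : ℂ :=
  ∫ x : ℝ, P.eval (x : ℂ) * gaussKernel s x

lemma norm_gaussKernel (s x : ℝ) : ‖gaussKernel s x‖ = Real.exp (-(1 / 2) * x ^ 2) := by
  rw [gaussKernel, Complex.norm_exp]
  congr 1
  have : Complex.I * s * x - x ^ 2 / 2 = ((-(1 / 2) * x ^ 2 : ℝ) : ℂ) + ((s * x : ℝ) : ℂ) * Complex.I := by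
    push_cast; ring
  rw [this, Complex.add_re, Complex.ofReal_re, Complex.re_ofReal_mul, Complex.I_re]
  ring

lemma continuous_gaussKernel (s : ℝ) : Continuous (gaussKernel s) := by
  unfold gaussKernel
  fun_prop

lemma continuous_eval_ofReal (P : ℂ[X]) : Continuous fun x : ℝ => P.eval (x : ℂ) :=
  P.continuous.comp Complex.continuous_ofReal

lemma hasDerivAt_gaussKernel (s x : ℝ) :
    HasDerivAt (gaussKernel s) ((Complex.I * s - x) * gaussKernel s x) x := by
  have h : HasDerivAt (fun z : ℂ => Complex.exp (Complex.I * s * z - z ^ 2 / 2))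
      ((Complex.I * s - x) * gaussKernel s x) (x : ℂ) := by
    have h1 : HasDerivAt (fun z : ℂ => Complex.I * s * z - z ^ 2 / 2) (Complex.I * s - x) (x : ℂ) := by
      have := ((hasDerivAt_id (x : ℂ)).const_mul (Complex.I * s)).sub
        (((hasDerivAt_id (x : ℂ)).pow 2).div_const 2)
      refine this.congr_deriv ?_
      simp
    refine h1.cexp.congr_deriv ?_
    rw [gaussKernel, mul_comm]
  exact h.comp_ofReal

lemma integrable_eval_mul_gaussKernel (s : ℝ) (P : ℂ[X]) :
    Integrable fun x : ℝ => P.eval (x : ℂ) * gaussKernel s x := by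
  induction P using Polynomial.induction_on' with
  | add p q hp hq =>
    simp only [eval_add, add_mul]
    exact hp.add hq
  | monomial n c =>
    have h := (integrable_rpow_mul_exp_neg_mul_sq (b := 1 / 2) (by norm_num) (s := n)
      (by linarith [n.cast_nonneg (α := ℝ)])).const_mul ‖c‖
    refine h.mono ?_ (Filter.Eventually.of_forall fun x => ?_)
    · exact ((continuous_eval_ofReal _).mul (continuous_gaussKernel s)).aestronglyMeasurable
    · simp [norm_gaussKernel, Real.rpow_natCast, mul_assoc]

lemma gaussFourier_add (s : ℝ) (P Q : ℂ[X]) :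
    gaussFourier s (P + Q) = gaussFourier s P + gaussFourier s Q := by
  simp only [gaussFourier, eval_add, add_mul]
  exact integral_add (integrable_eval_mul_gaussKernel s P) (integrable_eval_mul_gaussKernel s Q)

lemma gaussFourier_smul (s : ℝ) (c : ℂ) (P : ℂ[X]) :
    gaussFourier s (c • P) = c * gaussFourier s P := by
  simp only [gaussFourier, eval_smul, smul_eq_mul, mul_assoc]
  exact integral_const_mul _ _

/-- `gaussFourier` as a linear functional on polynomials. -/
def gaussFourierₗ (s : ℝ) : ℂ[X] →ₗ[ℂ] ℂ where
  toFun := gaussFourier s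
  map_add' := gaussFourier_add s
  map_smul' := gaussFourier_smul s

lemma gaussFourierₗ_apply (s : ℝ) (P : ℂ[X]) : gaussFourierₗ s P = gaussFourier s P := rfl

/-- The operator `P ↦ P' + z P`. -/
def shiftDerivative (z : ℂ) : Module.End ℂ ℂ[X] := derivative + z • 1

lemma shiftDerivative_apply (z : ℂ) (P : ℂ[X]) :
    shiftDerivative z P = derivative P + z • P := rfl

/-- Integration by parts, since the kernel k satisfies k' = (is - x)k: under the integral,
multiplication by x acts as D + is. -/
lemma gaussFourier_X_mul (s : ℝ) (P : ℂ[X]) :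
    gaussFourier s (X * P) = gaussFourier s (shiftDerivative (Complex.I * s) P) := by
  have h := integral_mul_deriv_eq_deriv_mul_of_integrable
    (u := fun x : ℝ => P.eval (x : ℂ)) (u' := fun x : ℝ => P.derivative.eval (x : ℂ))
    (v := gaussKernel s) (v' := fun x : ℝ => (Complex.I * s - x) * gaussKernel s x)
    (fun x _ => (P.hasDerivAt (x : ℂ)).comp_ofReal) (fun x _ => hasDerivAt_gaussKernel s x)
    ((integrable_eval_mul_gaussKernel s (P * (C (Complex.I * s) - X))).congr
      (Filter.Eventually.of_forall fun x => by simp [mul_assoc]))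
    (integrable_eval_mul_gaussKernel s (derivative P)) (integrable_eval_mul_gaussKernel s P)
  have h1 : (∫ x : ℝ, P.eval (x : ℂ) * ((Complex.I * s - x) * gaussKernel s x)) =
      gaussFourier s ((Complex.I * s) • P + (-1 : ℂ) • (X * P)) := by
    rw [gaussFourier]
    congr 1
    ext x
    simp only [eval_add, eval_smul, eval_mul, eval_X, smul_eq_mul]
    ring
  rw [h1, gaussFourier_add, gaussFourier_smul, gaussFourier_smul] at h
  rw [shiftDerivative_apply, gaussFourier_add, gaussFourier_smul]
  change _ = -gaussFourier s (derivative P) at h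
  linear_combination -h

/-- The probabilists' Hermite polynomials with complex coefficients. -/
def hermiteℂ (n : ℕ) : ℂ[X] := (hermite n).map (Int.castRingHom ℂ)

lemma hermiteℂ_zero : hermiteℂ 0 = 1 := by simp [hermiteℂ]

lemma hermiteℂ_succ (n : ℕ) :
    hermiteℂ (n + 1) = X * hermiteℂ n - derivative (hermiteℂ n) := by
  simp [hermiteℂ, hermite_succ, derivative_map]

lemma derivative_hermiteℂ_succ (n : ℕ) :
    derivative (hermiteℂ (n + 1)) = ((n + 1 : ℕ) : ℂ) • hermiteℂ n := by
  induction n with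
  | zero => simp [hermiteℂ_succ, hermiteℂ_zero]
  | succ n ih =>
    rw [hermiteℂ_succ (n + 1), derivative_sub, derivative_mul, derivative_X, ih, derivative_smul,
      hermiteℂ_succ n]
    simp only [smul_eq_C_mul]
    push_cast
    simp only [C_add, C_1]
    ring

lemma iterate_derivative_hermiteℂ (n j : ℕ) :
    ((derivative : ℂ[X] →ₗ[ℂ] ℂ[X]) ^ j) (hermiteℂ n) =
      (n.descFactorial j : ℂ) • hermiteℂ (n - j) := by
  induction j with
  | zero => simp
  | succ j ih =>
    rw [pow_succ', Module.End.mul_apply, ih, map_smul]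
    rcases lt_or_ge j n with h | h
    · obtain ⟨r, rfl⟩ := Nat.exists_eq_add_of_lt h
      rw [show j + r + 1 - j = r + 1 by omega, derivative_hermiteℂ_succ, smul_smul,
        Nat.descFactorial_succ, show j + r + 1 - (j + 1) = r by omega,
        show j + r + 1 - j = r + 1 by omega, ← Nat.cast_mul, mul_comm]
    -- Past the degree both sides vanish: the left differentiates a constant, and the falling
    -- factorial on the right is zero.
    · rw [Nat.sub_eq_zero_of_le h, Nat.descFactorial_of_lt (Nat.lt_succ_of_le h), hermiteℂ_zero]
      simp

/-- In He_{m+1} = x He_m - He_m', replacing x by D + is makes the product rule cancel the He_m' Q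
term. Each Hermite step thus becomes one application of D + is to Q. -/
lemma gaussFourier_hermiteℂ_mul (s : ℝ) (m : ℕ) (Q : ℂ[X]) :
    gaussFourier s (hermiteℂ m * Q) = gaussFourier s ((shiftDerivative (Complex.I * s) ^ m) Q) := by
  induction m generalizing Q with
  | zero => simp [hermiteℂ_zero]
  | succ m ih =>
    have h : hermiteℂ (m + 1) * Q =
        X * (hermiteℂ m * Q) + (-1 : ℂ) • (derivative (hermiteℂ m) * Q) := by
      rw [hermiteℂ_succ, neg_one_smul]; ring
    rw [pow_succ, Module.End.mul_apply, ← ih, h, gaussFourier_add, gaussFourier_X_mul,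
      ← gaussFourier_add]
    congr 1
    simp only [shiftDerivative_apply, derivative_mul, smul_eq_C_mul, map_neg, map_one]
    ring

lemma gaussFourier_hermiteℂ (s : ℝ) (m : ℕ) :
    gaussFourier s (hermiteℂ m) = (Complex.I * s) ^ m * gaussFourier s 1 := by
  have h : ∀ k, (shiftDerivative (Complex.I * s) ^ k) (1 : ℂ[X]) =
      ((Complex.I * s) ^ k) • (1 : ℂ[X]) := by
    intro k
    induction k with
    | zero => simp
    | succ k ih =>
      rw [pow_succ', Module.End.mul_apply, ih, map_smul, shiftDerivative_apply, derivative_one,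
        zero_add, smul_smul, pow_succ]
  rw [← mul_one (hermiteℂ m), gaussFourier_hermiteℂ_mul, h, gaussFourier_smul]

lemma shiftDerivative_pow_apply (z : ℂ) (m : ℕ) (P : ℂ[X]) :
    (shiftDerivative z ^ m) P = ∑ j ∈ Finset.range (m + 1),
      ((m.choose j : ℂ) * z ^ (m - j)) • ((derivative : ℂ[X] →ₗ[ℂ] ℂ[X]) ^ j) P := by
  have hc : Commute (derivative : Module.End ℂ ℂ[X]) (z • 1) :=
    (Commute.one_right _).smul_right z
  rw [shiftDerivative, hc.add_pow, LinearMap.sum_apply]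
  refine Finset.sum_congr rfl fun j _ => ?_
  rw [_root_.smul_pow, one_pow, mul_smul_comm, mul_one, smul_mul_assoc, ← nsmul_eq_mul']
  rw [LinearMap.smul_apply, LinearMap.smul_apply, ← Nat.cast_smul_eq_nsmul ℂ, smul_smul, mul_comm]

lemma gaussFourier_one (s : ℝ) :
    gaussFourier s 1 = (Real.sqrt (2 * Real.pi) * Real.exp (-(s ^ 2) / 2) : ℝ) := by
  have h := fourierIntegral_gaussian (b := 1 / 2) (by norm_num) (s : ℂ)
  have h2 : gaussFourier s 1 =
      ∫ x : ℝ, Complex.exp (Complex.I * s * x) * Complex.exp (-(1 / 2) * x ^ 2) := by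
    rw [gaussFourier]
    congr 1
    ext x
    rw [eval_one, one_mul, gaussKernel, ← Complex.exp_add]
    congr 1
    ring
  rw [h2, h, Complex.ofReal_mul, Complex.ofReal_exp, Real.sqrt_eq_rpow,
    Complex.ofReal_cpow (by positivity)]
  congr 1
  · push_cast
    congr 1
    ring
  · push_cast
    congr 1
    ring

/-- Matrix elements of `e^{isx}` in the basis of Hermite polynomials. -/
lemma gaussFourier_hermiteℂ_mul_hermiteℂ (s : ℝ) (n r : ℕ) :
    gaussFourier s (hermiteℂ n * hermiteℂ (n + r)) =
      (Complex.I * s) ^ r * (n.factorial * laguerre n r (s ^ 2) : ℝ) * gaussFourier s 1 := by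
  -- Moving the factor of lower degree n keeps every derivative order j at most n. Reflecting the
  -- sum to k = n - j produces (is)^(r+2k), and (is)² = -s² gives the powers of the Laguerre
  -- argument.
  rw [gaussFourier_hermiteℂ_mul, shiftDerivative_pow_apply, ← gaussFourierₗ_apply, map_sum,
    ← Finset.sum_range_reflect, laguerre]
  push_cast
  rw [Finset.mul_sum, Finset.mul_sum, Finset.sum_mul]
  refine Finset.sum_congr rfl fun k hk => ?_
  have hk' : k ≤ n := Nat.lt_succ_iff.mp (Finset.mem_range.mp hk)
  obtain ⟨j, rfl⟩ := Nat.exists_eq_add_of_le hk'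
  rw [map_smul, iterate_derivative_hermiteℂ, map_smul, gaussFourierₗ_apply, gaussFourier_hermiteℂ,
    show k + j - k = j by omega,
    show k + j - j = k by omega, show k + j + r - j = r + k by omega,
    Nat.descFactorial_eq_factorial_mul_choose]
  have h1 : ((k + j).factorial : ℂ) = ((k + j).choose j : ℂ) * j.factorial * k.factorial := by
    have := Nat.add_choose_mul_factorial_mul_factorial k j
    rw [← this]; push_cast; ring
  have h2 : (-(s : ℂ) ^ 2) ^ k = (Complex.I * s) ^ k * (Complex.I * s) ^ k := by
    rw [← mul_pow]; congr 1
    linear_combination (-(s : ℂ) ^ 2) * Complex.I_sq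
  have h3 : (k.factorial : ℂ) ≠ 0 := Nat.cast_ne_zero.mpr k.factorial_ne_zero
  rw [h1, h2]
  simp only [smul_eq_mul]
  push_cast
  field_simp
  ring

/-! ### Determinantal expansion of the eigenvalue weight -/

lemma hermiteℂ_natDegree (n : ℕ) : (hermiteℂ n).natDegree = n := by
  rw [hermiteℂ, (hermite_monic n).natDegree_map, natDegree_hermite]

lemma hermiteℂ_monic (n : ℕ) : (hermiteℂ n).Monic := (hermite_monic n).map _

/-- Monic polynomials of degrees 0, ..., d-1 have the same determinant as the monomials. -/
lemma prod_sub_sq_eq_det_hermiteℂ_sq {d : ℕ} (l : Fin d → ℝ) :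
    ((∏ i, ∏ j ∈ Finset.Ioi i, (l i - l j) ^ 2 : ℝ) : ℂ) =
      (Matrix.of fun i j : Fin d => (hermiteℂ j).eval (l i : ℂ)).det ^ 2 := by
  rw [← Matrix.det_eval_matrixOfPolynomials_eq_det_vandermonde (fun i => (l i : ℂ))
    (fun j => hermiteℂ j) (fun i => hermiteℂ_natDegree i) (fun i => hermiteℂ_monic i),
    Matrix.det_vandermonde, ← Finset.prod_pow]
  push_cast
  refine Finset.prod_congr rfl fun i _ => ?_
  rw [← Finset.prod_pow]
  exact Finset.prod_congr rfl fun j _ => by ring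

lemma gueWeight_mul_exp_eq_sum {d : ℕ} (s l : Fin d → ℝ) :
    (gueWeight d 1 l : ℂ) * Complex.exp (Complex.I * ∑ i, (s i : ℂ) * l i) =
      ∑ σ : Equiv.Perm (Fin d), ∑ τ : Equiv.Perm (Fin d),
        (((Equiv.Perm.sign σ : ℤ) : ℂ) * ((Equiv.Perm.sign τ : ℤ) : ℂ)) *
          ∏ i, ((hermiteℂ (σ i) * hermiteℂ (τ i)).eval (l i : ℂ) * gaussKernel (s i) (l i)) := by
  have hexp : (Real.exp (-(1 / 2) * ∑ i, l i ^ 2) : ℂ) *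
      Complex.exp (Complex.I * ∑ i, (s i : ℂ) * l i) = ∏ i, gaussKernel (s i) (l i) := by
    simp only [gaussKernel]
    rw [← Complex.exp_sum, Complex.ofReal_exp, ← Complex.exp_add]
    congr 1
    push_cast
    rw [Finset.mul_sum, Finset.mul_sum, ← Finset.sum_add_distrib]
    exact Finset.sum_congr rfl fun i _ => by ring
  rw [gueWeight, Complex.ofReal_mul, prod_sub_sq_eq_det_hermiteℂ_sq, mul_right_comm, hexp,
    -- Transposing makes each product run over the variables `l i`, so that the integrand factorises
    -- coordinatewise.
    ← Matrix.det_transpose, Matrix.det_apply', sq, Finset.sum_mul_sum, Finset.mul_sum]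
  refine Finset.sum_congr rfl fun σ _ => ?_
  rw [Finset.mul_sum]
  refine Finset.sum_congr rfl fun τ _ => ?_
  simp only [Matrix.transpose_apply, Matrix.of_apply, eval_mul, Finset.prod_mul_distrib]
  ring

lemma integrable_gueWeight_mul_exp {d : ℕ} (s : Fin d → ℝ) :
    Integrable fun l : Fin d → ℝ =>
      (gueWeight d 1 l : ℂ) * Complex.exp (Complex.I * ∑ i, (s i : ℂ) * l i) := by
  simp only [gueWeight_mul_exp_eq_sum]
  refine integrable_finsetSum _ fun σ _ => integrable_finsetSum _ fun τ _ => Integrable.const_mul ?_ _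
  exact Integrable.fintype_prod (fun i => integrable_eval_mul_gaussKernel (s i) _)

lemma integral_gueWeight_mul_exp_eq_sum {d : ℕ} (s : Fin d → ℝ) :
    (∫ l : Fin d → ℝ,
      (gueWeight d 1 l : ℂ) * Complex.exp (Complex.I * ∑ i, (s i : ℂ) * l i)) =
      ∑ σ : Equiv.Perm (Fin d), ∑ π : Equiv.Perm (Fin d), ((Equiv.Perm.sign π : ℤ) : ℂ) *
          ∏ i, gaussFourier (s i) (hermiteℂ (σ i) * hermiteℂ (σ (π i))) := by
  simp only [gueWeight_mul_exp_eq_sum]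
  have hint : ∀ σ τ : Equiv.Perm (Fin d), Integrable fun l : Fin d → ℝ =>
      (((Equiv.Perm.sign σ : ℤ) : ℂ) * ((Equiv.Perm.sign τ : ℤ) : ℂ)) *
      ∏ i, ((hermiteℂ (σ i) * hermiteℂ (τ i)).eval (l i : ℂ) * gaussKernel (s i) (l i)) :=
    fun σ τ => (Integrable.fintype_prod
      (fun i => integrable_eval_mul_gaussKernel (s i) _)).const_mul _
  rw [integral_finsetSum _ fun σ _ => integrable_finsetSum _ fun τ _ => hint σ τ]
  refine Finset.sum_congr rfl fun σ _ => ?_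
  rw [integral_finsetSum _ fun τ _ => hint σ τ]
  -- Substituting τ = σπ turns sign σ · sign τ into sign π.
  rw [← Equiv.sum_comp (Equiv.mulLeft σ)]
  refine Finset.sum_congr rfl fun π _ => ?_
  rw [Equiv.coe_mulLeft, integral_const_mul, integral_fintype_prod_volume_eq_prod
    (fun i (x : ℝ) => (hermiteℂ (σ i) * hermiteℂ ((σ * π) i)).eval (x : ℂ) * gaussKernel (s i) x)]
  congr 1
  simp only [Equiv.Perm.sign_mul]
  rw [Units.val_mul, Int.cast_mul, ← mul_assoc, ← Int.cast_mul, Int.units_coe_mul_self]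
  simp

/-! ### Orthogonality and two-level correlations. -/

lemma gaussFourier_zero_hermiteℂ_mul_of_ne {n m : ℕ} (h : n ≠ m) :
    gaussFourier 0 (hermiteℂ n * hermiteℂ m) = 0 := by
  wlog hnm : n < m generalizing n m with H
  · rw [mul_comm]
    exact H h.symm (lt_of_le_of_ne (not_lt.mp hnm) h.symm)
  obtain ⟨r, rfl⟩ := Nat.exists_eq_add_of_lt hnm
  rw [add_assoc, gaussFourier_hermiteℂ_mul_hermiteℂ]
  simp

/-- The norm squared of the `n`-th Hermite polynomial. -/
def hermiteNorm (n : ℕ) : ℝ := n.factorial * Real.sqrt (2 * Real.pi)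

lemma hermiteNorm_pos (n : ℕ) : 0 < hermiteNorm n := by
  unfold hermiteNorm; positivity

lemma laguerre_zero (n : ℕ) : laguerre n 0 0 = 1 := by
  rw [laguerre, Finset.sum_eq_single 0]
  · simp
  · intro k _ hk
    simp [zero_pow hk]
  · simp

lemma gaussFourier_zero_hermiteℂ_mul_self (n : ℕ) :
    gaussFourier 0 (hermiteℂ n * hermiteℂ n) = hermiteNorm n := by
  have h := gaussFourier_hermiteℂ_mul_hermiteℂ 0 n 0
  simp only [add_zero] at h
  rw [h, gaussFourier_one]
  simp [laguerre_zero, hermiteNorm]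

/-- The two-level correlation of `e^{ic(x - y)}` in the Hermite levels `n` and `m`. -/
def levelCorrelation (c : ℝ) (n m : ℕ) : ℂ :=
  (gaussFourier c (hermiteℂ n * hermiteℂ n) * gaussFourier (-c) (hermiteℂ m * hermiteℂ m) -
    gaussFourier c (hermiteℂ n * hermiteℂ m) * gaussFourier (-c) (hermiteℂ m * hermiteℂ n)) /
      (hermiteNorm n * hermiteNorm m)

lemma levelCorrelation_zero {n m : ℕ} (h : n ≠ m) : levelCorrelation 0 n m = 1 := by
  have hn := Complex.ofReal_ne_zero.mpr (hermiteNorm_pos n).ne'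
  have hm := Complex.ofReal_ne_zero.mpr (hermiteNorm_pos m).ne'
  simp only [levelCorrelation, neg_zero, gaussFourier_zero_hermiteℂ_mul_self,
    gaussFourier_zero_hermiteℂ_mul_of_ne h, zero_mul, sub_zero]
  exact div_self (mul_ne_zero hn hm)

/-- Closed form of the two-level correlation. -/
def levelFormula (c : ℝ) (n m : ℕ) : ℝ :=
  (laguerre n 0 (c ^ 2) * laguerre m 0 (c ^ 2) -
    (n.factorial : ℝ) / (m.factorial : ℝ) * c ^ (2 * (m - n)) * laguerre n (m - n) (c ^ 2) ^ 2) *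
      Real.exp (-c ^ 2)

lemma gaussFourier_hermiteℂ_mul_self (c : ℝ) (n : ℕ) :
    gaussFourier c (hermiteℂ n * hermiteℂ n) =
      (n.factorial * laguerre n 0 (c ^ 2) : ℝ) * gaussFourier c 1 := by
  simpa using gaussFourier_hermiteℂ_mul_hermiteℂ c n 0

lemma levelCorrelation_comm (c : ℝ) (n m : ℕ) :
    levelCorrelation c m n = levelCorrelation c n m := by
  have h : ∀ k, gaussFourier (-c) (hermiteℂ k * hermiteℂ k) =
      gaussFourier c (hermiteℂ k * hermiteℂ k) := by
    intro k
    simp only [gaussFourier_hermiteℂ_mul_self, gaussFourier_one, neg_sq]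
  simp only [levelCorrelation, h, mul_comm (hermiteℂ m) (hermiteℂ n)]
  ring

lemma levelCorrelation_eq (c : ℝ) {n m : ℕ} (hnm : n ≤ m) :
    levelCorrelation c n m = levelFormula c n m := by
  obtain ⟨r, rfl⟩ := Nat.exists_eq_add_of_le hnm
  have hg : gaussFourier (-c) 1 = gaussFourier c 1 := by
    simp only [gaussFourier_one, neg_sq]
  -- Two factors e^{-c²/2} combine into the final Gaussian; the 2π cancels against the Hermite
  -- norms.
  have h2 : gaussFourier c 1 * gaussFourier c 1 =
      ((2 * Real.pi) * Real.exp (-c ^ 2) : ℝ) := by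
    rw [gaussFourier_one, ← Complex.ofReal_mul]
    congr 1
    rw [mul_mul_mul_comm, Real.mul_self_sqrt (by positivity), ← Real.exp_add]
    congr 2
    ring
  have h3 : (Complex.I * c) ^ r * (Complex.I * ((-c : ℝ) : ℂ)) ^ r = ((c ^ (2 * r) : ℝ) : ℂ) := by
    rw [← mul_pow, pow_mul]
    push_cast
    congr 1
    linear_combination (-(c : ℂ) ^ 2) * Complex.I_sq
  have hpi : (Real.sqrt (2 * Real.pi) : ℂ) * Real.sqrt (2 * Real.pi) = ((2 * Real.pi : ℝ) : ℂ) := by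
    rw [← Complex.ofReal_mul, Real.mul_self_sqrt (by positivity)]
  have hpi0 : ((2 * Real.pi : ℝ) : ℂ) ≠ 0 := by
    rw [Complex.ofReal_ne_zero]; positivity
  have hn : (n.factorial : ℂ) ≠ 0 := Nat.cast_ne_zero.mpr n.factorial_ne_zero
  have hm : ((n + r).factorial : ℂ) ≠ 0 := Nat.cast_ne_zero.mpr (n + r).factorial_ne_zero
  have hden : (hermiteNorm n : ℂ) * hermiteNorm (n + r) =
      n.factorial * (n + r).factorial * ((2 * Real.pi : ℝ) : ℂ) := by
    rw [← hpi]; simp only [hermiteNorm]; push_cast; ring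
  have hnum : gaussFourier c (hermiteℂ n * hermiteℂ n) *
        gaussFourier (-c) (hermiteℂ (n + r) * hermiteℂ (n + r)) -
      gaussFourier c (hermiteℂ n * hermiteℂ (n + r)) *
        gaussFourier (-c) (hermiteℂ (n + r) * hermiteℂ n) =
      (n.factorial * (n + r).factorial * (laguerre n 0 (c ^ 2) * laguerre (n + r) 0 (c ^ 2)) -
        c ^ (2 * r) * (n.factorial * laguerre n r (c ^ 2)) ^ 2 : ℝ) *
        (gaussFourier c 1 * gaussFourier c 1) := by
    rw [mul_comm (hermiteℂ (n + r)) (hermiteℂ n)]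
    simp only [gaussFourier_hermiteℂ_mul_self, gaussFourier_hermiteℂ_mul_hermiteℂ, hg, neg_sq]
    rw [Complex.ofReal_sub, Complex.ofReal_mul (c ^ (2 * r)), ← h3]
    push_cast
    ring
  rw [levelCorrelation, hnum, hden, h2, levelFormula, Nat.add_sub_cancel_left]
  rw [div_eq_iff (mul_ne_zero (mul_ne_zero hn hm) hpi0)]
  push_cast
  field_simp

/-- The Andréief expansion of the two-point function of the eigenvalue weight. -/
lemma integral_gueWeight_mul_exp_sub {d : ℕ} (c : ℝ) {p q : Fin d} (hpq : p ≠ q) :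
    (∫ l : Fin d → ℝ, (gueWeight d 1 l : ℂ) * Complex.exp (Complex.I * (c * (l p - l q)))) =
      (∏ n : Fin d, (hermiteNorm n : ℂ)) *
        ∑ σ : Equiv.Perm (Fin d), levelCorrelation c (σ p) (σ q) := by
  -- The exponential has frequency c at p, -c at q and 0 elsewhere.
  set s : Fin d → ℝ := fun i => if i = p then c else if i = q then -c else 0 with hs
  have hsp : s p = c := by simp [hs]
  have hsq : s q = -c := by simp [hs, hpq.symm]
  have hs0 : ∀ i, i ≠ p → i ≠ q → s i = 0 := fun i h1 h2 => by simp [hs, h1, h2]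
  have hsplit : ∀ f : Fin d → ℂ, ∏ i, f i = f p * f q * ∏ i ∈ (Finset.univ.erase p).erase q, f i := by
    intro f
    rw [← Finset.mul_prod_erase Finset.univ f (Finset.mem_univ p),
      ← Finset.mul_prod_erase (Finset.univ.erase p) f (a := q) (by simp [hpq.symm]), mul_assoc]
  have hsum : ∀ l : Fin d → ℝ, ∑ i, (s i : ℂ) * l i = c * (l p - l q) := by
    intro l
    rw [← Finset.add_sum_erase Finset.univ _ (Finset.mem_univ p),
      ← Finset.add_sum_erase (Finset.univ.erase p) _ (a := q) (by simp [hpq.symm]),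
      Finset.sum_eq_zero, hsp, hsq]
    · push_cast; ring
    · intro i hi
      simp only [Finset.mem_erase] at hi
      rw [hs0 i hi.2.1 hi.1]; simp
  simp only [← hsum]
  rw [integral_gueWeight_mul_exp_eq_sum, Finset.mul_sum]
  refine Finset.sum_congr rfl fun σ _ => ?_
  have hne : (1 : Equiv.Perm (Fin d)) ≠ Equiv.swap p q := by
    intro h
    exact hpq (by simpa using congrArg (fun e : Equiv.Perm (Fin d) => e p) h)
  rw [Fintype.sum_eq_add _ _ hne]
  · have hK : (∏ n : Fin d, (hermiteNorm n : ℂ)) = ∏ i, (hermiteNorm (σ i) : ℂ) :=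
      (Equiv.prod_comp σ (fun n : Fin d => (hermiteNorm n : ℂ))).symm
    have hrest : ∀ π : Equiv.Perm (Fin d), (∀ i, i ≠ p → i ≠ q → π i = i) →
        ∏ i ∈ (Finset.univ.erase p).erase q,
          gaussFourier (s i) (hermiteℂ (σ i) * hermiteℂ (σ (π i))) =
        ∏ i ∈ (Finset.univ.erase p).erase q, (hermiteNorm (σ i) : ℂ) := by
      intro π hπ
      refine Finset.prod_congr rfl fun i hi => ?_
      simp only [Finset.mem_erase] at hi
      rw [hπ i hi.2.1 hi.1, hs0 i hi.2.1 hi.1, gaussFourier_zero_hermiteℂ_mul_self]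
    rw [hK, hsplit, hsplit, hsplit, hrest 1 (fun _ _ _ => rfl),
      hrest _ (fun i h1 h2 => Equiv.swap_apply_of_ne_of_ne h1 h2), hsp, hsq, levelCorrelation]
    have hn := Complex.ofReal_ne_zero.mpr (hermiteNorm_pos (σ p)).ne'
    have hm := Complex.ofReal_ne_zero.mpr (hermiteNorm_pos (σ q)).ne'
    rw [Equiv.Perm.sign_swap hpq]
    simp only [Equiv.Perm.sign_one, Equiv.Perm.one_apply, Equiv.swap_apply_left,
      Equiv.swap_apply_right]
    push_cast
    field_simp
    ring
  -- A permutation other than the identity and the swap moves some third index, where the frequency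
  -- is zero and orthogonality kills the factor.
  · rintro π ⟨h1, h2⟩
    have : ∃ i, i ≠ p ∧ i ≠ q ∧ π i ≠ i := by
      by_contra! H
      have hmem : ∀ i, (i = p ∨ i = q) → (π i = p ∨ π i = q) := by
        intro i hi
        by_contra! h
        have := π.injective (H (π i) h.1 h.2)
        rcases hi with rfl | rfl <;> tauto
      rcases hmem p (Or.inl rfl) with hp | hp
      · apply h1
        ext i
        by_cases hip : i = p
        · simp [hip, hp]
        by_cases hiq : i = q
        · rcases hmem q (Or.inr rfl) with hq | hq
          · exact absurd (π.injective (hp.trans hq.symm)) hpq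
          · simp [hiq, hq]
        · simp [H i hip hiq]
      · apply h2
        ext i
        by_cases hip : i = p
        · simp [hip, hp]
        by_cases hiq : i = q
        · rcases hmem q (Or.inr rfl) with hq | hq
          · simp [hiq, hq]
          · exact absurd (π.injective (hp.trans hq.symm)) hpq
        · simp [H i hip hiq, Equiv.swap_apply_of_ne_of_ne hip hiq]
    obtain ⟨i, hip, hiq, hi⟩ := this
    rw [Finset.prod_eq_zero (Finset.mem_univ i), mul_zero]
    rw [hs0 i hip hiq]
    exact gaussFourier_zero_hermiteℂ_mul_of_ne
      (fun h => hi (σ.injective (Fin.val_injective h)).symm)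

end Hermite

/-! ### The eigenvalue distribution -/

lemma gueWeight_nonneg (d : ℕ) (η : ℝ) (l : Fin d → ℝ) : 0 ≤ gueWeight d η l :=
  mul_nonneg (Real.exp_nonneg _)
    (Finset.prod_nonneg fun _ _ => Finset.prod_nonneg fun _ _ => sq_nonneg _)

lemma continuous_gueWeight (d : ℕ) (η : ℝ) : Continuous (gueWeight d η) := by
  unfold gueWeight
  fun_prop

/-- Each pair i < j contributes one factor η. The constant stays an unevaluated product because it
cancels in normalised averages. -/
lemma gueWeight_one_smul {d : ℕ} {η : ℝ} (hη : 0 ≤ η) (l : Fin d → ℝ) :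
    gueWeight d 1 (Real.sqrt η • l) =
      (∏ i : Fin d, ∏ _j ∈ Finset.Ioi i, η) * gueWeight d η l := by
  have h : ∀ x y : ℝ, (Real.sqrt η * x - Real.sqrt η * y) ^ 2 = η * (x - y) ^ 2 := fun x y => by
    rw [← mul_sub, mul_pow, Real.sq_sqrt hη]
  simp only [gueWeight, Pi.smul_apply, smul_eq_mul, h, Finset.prod_mul_distrib, mul_pow,
    Real.sq_sqrt hη, ← Finset.mul_sum]
  rw [mul_left_comm]
  congr 3
  ring

/-- The two-point formula at c = 0, where every level correlation is 1; it needs two distinct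
indices, hence d ≥ 2. -/
lemma integral_gueWeight_eq {d : ℕ} (hd : 2 ≤ d) :
    ∫ l : Fin d → ℝ, gueWeight d 1 l = (∏ n : Fin d, hermiteNorm n) * d.factorial := by
  have hpq : (⟨0, by omega⟩ : Fin d) ≠ ⟨1, by omega⟩ := by simp
  have h := integral_gueWeight_mul_exp_sub 0 hpq
  simp only [Complex.ofReal_zero, zero_mul, mul_zero, Complex.exp_zero, mul_one] at h
  have h2 : ∀ σ : Equiv.Perm (Fin d),
      levelCorrelation 0 (σ ⟨0, by omega⟩) (σ ⟨1, by omega⟩) = 1 := fun σ =>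
    levelCorrelation_zero fun h => hpq (σ.injective (Fin.val_injective h))
  simp only [h2] at h
  rw [integral_complex_ofReal] at h
  apply Complex.ofReal_injective
  rw [h]
  simp [Fintype.card_perm]

lemma integrable_gueWeight_one (d : ℕ) : Integrable (gueWeight d 1) := by
  have h := integrable_gueWeight_mul_exp (d := d) 0
  simp only [Pi.zero_apply, Complex.ofReal_zero, zero_mul, Finset.sum_const_zero, mul_zero,
    Complex.exp_zero, mul_one] at h
  exact h.re

lemma two_mul_cosineSum_eq_sum_exp {d : ℕ} (a a' t : ℝ) (l : Fin d → ℝ) :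
    ((2 * cosineSum a a' t l : ℝ) : ℂ) = ∑ p, ∑ q ∈ ({p}ᶜ : Finset (Fin d)),
      Complex.exp (Complex.I * (((a - a') * t : ℝ) * (l p - l q))) := by
  rw [← Finset.sum_sum_Ioi_add_eq_sum_sum_off_diag
    (fun q p => Complex.exp (Complex.I * (((a - a') * t : ℝ) * (l p - l q)))), cosineSum,
    Finset.mul_sum, Complex.ofReal_sum]
  refine Finset.sum_congr rfl fun m _ => ?_
  rw [Finset.mul_sum, Complex.ofReal_sum]
  refine Finset.sum_congr rfl fun n _ => ?_
  rw [Complex.ofReal_mul, Complex.ofReal_cos, Complex.ofReal_ofNat, Complex.two_cos, add_comm]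
  congr 2 <;> (push_cast; ring)

lemma integral_gueWeight_mul_cosineSum {d : ℕ} (a a' t : ℝ) :
    ∫ l : Fin d → ℝ, gueWeight d 1 l * cosineSum a a' t l =
      (∏ n : Fin d, hermiteNorm n) * d.factorial *
        ∑ n : Fin d, ∑ m ∈ Finset.Ioi n, levelFormula ((a - a') * t) n m := by
  set c := (a - a') * t with hc
  have hint : ∀ p q : Fin d, Integrable fun l : Fin d → ℝ =>
      (gueWeight d 1 l : ℂ) * Complex.exp (Complex.I * (c * (l p - l q))) := by
    intro p q
    refine (integrable_gueWeight_one d).ofReal.mul_bdd (c := 1) ?_ ?_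
    · exact Continuous.aestronglyMeasurable (by fun_prop)
    · refine Filter.Eventually.of_forall fun l => le_of_eq ?_
      rw [mul_comm, ← Complex.ofReal_sub, ← Complex.ofReal_mul, Complex.norm_exp_ofReal_mul_I]
  have h1 : (∫ l : Fin d → ℝ, ((gueWeight d 1 l * (2 * cosineSum a a' t l) : ℝ) : ℂ)) =
      (∏ n : Fin d, (hermiteNorm n : ℂ)) * (d.factorial *
        ∑ p : Fin d, ∑ q ∈ ({p}ᶜ : Finset (Fin d)), levelCorrelation c p q) := by
    have hpt : ∀ l : Fin d → ℝ, ((gueWeight d 1 l * (2 * cosineSum a a' t l) : ℝ) : ℂ) =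
        ∑ p, ∑ q ∈ ({p}ᶜ : Finset (Fin d)),
          (gueWeight d 1 l : ℂ) * Complex.exp (Complex.I * (c * (l p - l q))) := by
      intro l
      rw [Complex.ofReal_mul, two_mul_cosineSum_eq_sum_exp]
      simp only [Finset.mul_sum, hc]
    simp only [hpt]
    rw [integral_finsetSum _ fun p _ => integrable_finsetSum _ fun q _ => hint p q]
    have h2 : ∀ p : Fin d, (∫ l : Fin d → ℝ, ∑ q ∈ ({p}ᶜ : Finset (Fin d)),
          (gueWeight d 1 l : ℂ) * Complex.exp (Complex.I * (c * (l p - l q)))) =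
        ∑ q ∈ ({p}ᶜ : Finset (Fin d)), (∏ n : Fin d, (hermiteNorm n : ℂ)) *
          ∑ σ : Equiv.Perm (Fin d), levelCorrelation c (σ p) (σ q) := by
      intro p
      rw [integral_finsetSum _ fun q _ => hint p q]
      refine Finset.sum_congr rfl fun q hq => ?_
      exact integral_gueWeight_mul_exp_sub c (by simpa [eq_comm] using hq)
    simp only [h2]
    simp only [← Finset.mul_sum]
    congr 1
    -- Every σ permutes the ordered pairs of distinct indices, so the sum over σ contributes a
    -- factor d!.
    have h3 : ∀ σ : Equiv.Perm (Fin d), (∑ p, ∑ q ∈ ({p}ᶜ : Finset (Fin d)),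
        levelCorrelation c (σ p) (σ q)) =
        ∑ p : Fin d, ∑ q ∈ ({p}ᶜ : Finset (Fin d)), levelCorrelation c p q := by
      intro σ
      rw [← Equiv.sum_comp σ
        (fun p : Fin d => ∑ q ∈ ({p}ᶜ : Finset (Fin d)), levelCorrelation c p q)]
      refine Finset.sum_congr rfl fun p _ => ?_
      refine Finset.sum_equiv σ (fun q => ?_) (fun _ _ => rfl)
      simp
    calc _ = ∑ σ : Equiv.Perm (Fin d), ∑ p, ∑ q ∈ ({p}ᶜ : Finset (Fin d)),
          levelCorrelation c (σ p) (σ q) := by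
          rw [Finset.sum_comm]
          exact Finset.sum_congr rfl fun p _ => Finset.sum_comm
      _ = _ := by simp [h3, Fintype.card_perm]
  have h4 : (∑ p : Fin d, ∑ q ∈ ({p}ᶜ : Finset (Fin d)), levelCorrelation c p q) =
      ((2 * ∑ n : Fin d, ∑ m ∈ Finset.Ioi n, levelFormula c n m : ℝ) : ℂ) := by
    rw [← Finset.sum_sum_Ioi_add_eq_sum_sum_off_diag
      (fun q p : Fin d => levelCorrelation c p q), Finset.mul_sum, Complex.ofReal_sum]
    refine Finset.sum_congr rfl fun n _ => ?_
    rw [Finset.mul_sum, Complex.ofReal_sum]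
    refine Finset.sum_congr rfl fun m hm => ?_
    have hnm : (n : ℕ) ≤ m := (Fin.le_def.mp (Finset.mem_Ioi.mp hm).le)
    rw [levelCorrelation_comm c n m, levelCorrelation_eq c hnm]
    push_cast; ring
  rw [integral_complex_ofReal, h4] at h1
  have h5 : (∫ l : Fin d → ℝ, gueWeight d 1 l * (2 * cosineSum a a' t l)) =
      (∏ n : Fin d, hermiteNorm n) * (d.factorial *
        (2 * ∑ n : Fin d, ∑ m ∈ Finset.Ioi n, levelFormula c n m)) := by
    apply Complex.ofReal_injective
    rw [h1]; push_cast; rfl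
  have h6 : (∫ l : Fin d → ℝ, gueWeight d 1 l * (2 * cosineSum a a' t l)) =
      2 * ∫ l : Fin d → ℝ, gueWeight d 1 l * cosineSum a a' t l := by
    rw [← integral_const_mul]
    congr 1; ext l; ring
  rw [h6] at h5
  linear_combination h5 / 2

/-- The index n = d-1 in `guePolynomial` carries an empty inner sum, so both index sets are the
pairs n < m < d. -/
lemma sum_levelFormula (d : ℕ) (c : ℝ) :
    ∑ n : Fin d, ∑ m ∈ Finset.Ioi n, levelFormula c n m =
      guePolynomial d c * Real.exp (-c ^ 2) := by
  rw [guePolynomial, Finset.sum_mul, ← Fin.sum_univ_eq_sum_range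
    (fun n => (∑ m ∈ Finset.Ioo n d, _) * Real.exp (-c ^ 2))]
  refine Finset.sum_congr rfl fun n _ => ?_
  rw [Finset.sum_mul, ← Fin.map_valEmbedding_Ioi, Finset.sum_map]
  rfl

lemma integral_gueWeight_mul {d : ℕ} {η : ℝ} (hη : 0 < η) (f : (Fin d → ℝ) → ℝ) :
    ∫ l : Fin d → ℝ, gueWeight d η l * f l =
      ((∏ i : Fin d, ∏ _j ∈ Finset.Ioi i, η)⁻¹ * (Real.sqrt η ^ d)⁻¹) *
        ∫ l : Fin d → ℝ, gueWeight d 1 l * f ((Real.sqrt η)⁻¹ • l) := by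
  have hs : Real.sqrt η ≠ 0 := (Real.sqrt_pos.mpr hη).ne'
  have hC : (∏ i : Fin d, ∏ _j ∈ Finset.Ioi i, η) ≠ 0 :=
    Finset.prod_ne_zero_iff.mpr fun i _ => Finset.prod_ne_zero_iff.mpr fun _ _ => hη.ne'
  have h := Measure.integral_comp_smul_of_nonneg (volume : Measure (Fin d → ℝ))
    (fun l => gueWeight d 1 l * f ((Real.sqrt η)⁻¹ • l)) (Real.sqrt η) (hR := Real.sqrt_nonneg η)
  simp only [gueWeight_one_smul hη.le, smul_smul, inv_mul_cancel₀ hs, one_smul, mul_assoc,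
    integral_const_mul, Module.finrank_fin_fun, smul_eq_mul] at h
  rw [mul_assoc, ← h, ← mul_assoc, inv_mul_cancel₀ hC, one_mul]

lemma integral_gueWeight_pos {d : ℕ} (hd : 2 ≤ d) {η : ℝ} (hη : 0 < η) :
    0 < ∫ l : Fin d → ℝ, gueWeight d η l := by
  have h := integral_gueWeight_mul (d := d) hη (fun _ => 1)
  simp only [mul_one] at h
  rw [h, integral_gueWeight_eq hd]
  have h1 : 0 < ∏ i : Fin d, ∏ _j ∈ Finset.Ioi i, η :=
    Finset.prod_pos fun _ _ => Finset.prod_pos fun _ _ => hη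
  have h2 : 0 < ∏ n : Fin d, hermiteNorm n := Finset.prod_pos fun n _ => hermiteNorm_pos n
  have h3 := Real.sqrt_pos.mpr hη
  positivity

/-- A Bochner integral is 0 for a non-integrable function, so the positive value already forces
integrability. -/
lemma integrable_gueWeight {d : ℕ} (hd : 2 ≤ d) {η : ℝ} (hη : 0 < η) :
    Integrable (gueWeight d η) :=
  Integrable.of_integral_ne_zero (integral_gueWeight_pos hd hη).ne'

lemma guePartition_eq {d : ℕ} (hd : 2 ≤ d) {η : ℝ} (hη : 0 < η) :
    guePartition d η = ENNReal.ofReal (∫ l : Fin d → ℝ, gueWeight d η l) :=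
  (ofReal_integral_eq_lintegral_ofReal (integrable_gueWeight hd hη)
    (Filter.Eventually.of_forall (gueWeight_nonneg d η))).symm

lemma isProbabilityMeasure_gueEigenvalues {d : ℕ} (hd : 2 ≤ d) {η : ℝ} (hη : 0 < η) :
    IsProbabilityMeasure (gueEigenvalues d η) := by
  constructor
  rw [gueEigenvalues, Measure.smul_apply, withDensity_apply _ MeasurableSet.univ,
    Measure.restrict_univ, smul_eq_mul]
  change (guePartition d η)⁻¹ * guePartition d η = 1
  rw [guePartition_eq hd hη]
  exact ENNReal.inv_mul_cancel
    (ENNReal.ofReal_pos.mpr (integral_gueWeight_pos hd hη)).ne' ENNReal.ofReal_ne_top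

lemma integral_gueEigenvalues {d : ℕ} (hd : 2 ≤ d) {η : ℝ} (hη : 0 < η)
    (f : (Fin d → ℝ) → ℝ) :
    ∫ l, f l ∂(gueEigenvalues d η) =
      (∫ l : Fin d → ℝ, gueWeight d η l)⁻¹ * ∫ l : Fin d → ℝ, gueWeight d η l * f l := by
  rw [gueEigenvalues, integral_smul_measure, integral_withDensity_eq_integral_toReal_smul
    (continuous_gueWeight d η).measurable.ennreal_ofReal
    (Filter.Eventually.of_forall fun _ => ENNReal.ofReal_lt_top), guePartition_eq hd hη,
    ENNReal.toReal_inv, ENNReal.toReal_ofReal (integral_gueWeight_pos hd hη).le, smul_eq_mul]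
  simp only [ENNReal.toReal_ofReal (gueWeight_nonneg d η _), smul_eq_mul]

lemma continuous_cosineSum {d : ℕ} (a a' t : ℝ) :
    Continuous (cosineSum a a' t : (Fin d → ℝ) → ℝ) := by
  unfold cosineSum
  fun_prop

lemma integrable_cosineSum {d : ℕ} (hd : 2 ≤ d) {η : ℝ} (hη : 0 < η) (a a' t : ℝ) :
    Integrable (fun l : Fin d → ℝ => cosineSum a a' t l) (gueEigenvalues d η) := by
  have := isProbabilityMeasure_gueEigenvalues hd hη
  refine Integrable.of_bound (continuous_cosineSum a a' t).aestronglyMeasurable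
    (∑ m : Fin d, ∑ _n ∈ Finset.Ioi m, (1 : ℝ)) (Filter.Eventually.of_forall fun l => ?_)
  refine (norm_sum_le _ _).trans (Finset.sum_le_sum fun m _ => ?_)
  exact (norm_sum_le _ _).trans (Finset.sum_le_sum fun n _ => Real.abs_cos_le_one _)

/-- The GUE average of the sum of cosines of eigenvalue differences. -/
lemma integral_cosineSum {d : ℕ} (hd : 2 ≤ d) {η : ℝ} (hη : 0 < η) (a a' t : ℝ) :
    ∫ l, cosineSum a a' t l ∂(gueEigenvalues d η) =
      guePolynomial d ((a - a') * t / Real.sqrt η) *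
        Real.exp (-((a - a') * t / Real.sqrt η) ^ 2) := by
  -- Rescaling the eigenvalues by 1/√η is absorbed into t.
  have hscale : ∀ l : Fin d → ℝ, cosineSum a a' t ((Real.sqrt η)⁻¹ • l) =
      cosineSum a a' (t / Real.sqrt η) l := by
    intro l
    refine Finset.sum_congr rfl fun m _ => Finset.sum_congr rfl fun n _ => ?_
    simp only [Pi.smul_apply, smul_eq_mul]
    congr 1; ring
  have h1 := integral_gueWeight_mul (d := d) hη (fun _ => 1)
  simp only [mul_one] at h1
  have h2 := integral_gueWeight_pos hd hη
  rw [integral_gueEigenvalues hd hη, integral_gueWeight_mul hη]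
  simp only [hscale]
  rw [integral_gueWeight_mul_cosineSum, ← integral_gueWeight_eq hd, sum_levelFormula,
    ← mul_assoc, ← mul_assoc, mul_assoc _ _ (∫ l : Fin d → ℝ, gueWeight d 1 l), ← h1,
    inv_mul_cancel₀ h2.ne', one_mul, mul_div_assoc]

/-! ### Haar moments on the unitary group -/

instance isHaarMeasure_haarUnitary (d : ℕ) : (haarUnitary d).IsHaarMeasure := by
  unfold haarUnitary; infer_instance

instance isProbabilityMeasure_haarUnitary (d : ℕ) : IsProbabilityMeasure (haarUnitary d) :=
  ⟨Measure.haarMeasure_self⟩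

/-- A right translate of Haar measure is again a Haar probability measure, hence equal to it by
uniqueness. -/
instance isMulRightInvariant_haarUnitary (d : ℕ) : (haarUnitary d).IsMulRightInvariant := by
  constructor
  intro V
  have : IsProbabilityMeasure ((haarUnitary d).map (· * V)) :=
    Measure.isProbabilityMeasure_map (measurable_mul_const V).aemeasurable
  exact Measure.isHaarMeasure_eq_of_isProbabilityMeasure _ _

lemma integrable_haarUnitary_of_continuous {d : ℕ} {E : Type*} [NormedAddCommGroup E]
    {f : Matrix.unitaryGroup (Fin d) ℂ → E} (hf : Continuous f) :
    Integrable f (haarUnitary d) :=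
  hf.integrable_of_hasCompactSupport (HasCompactSupport.of_compactSpace f)

/-- The matrix `U† ρ U`. -/
def rotate {d : ℕ} (ρ : Matrix (Fin d) (Fin d) ℂ) (U : Matrix.unitaryGroup (Fin d) ℂ) :
    Matrix (Fin d) (Fin d) ℂ :=
  (U : Matrix (Fin d) (Fin d) ℂ).conjTranspose * ρ * U

lemma continuous_rotate {d : ℕ} (ρ : Matrix (Fin d) (Fin d) ℂ) : Continuous (rotate ρ) := by
  unfold rotate
  exact ((continuous_subtype_val.matrix_conjTranspose).matrix_mul continuous_const).matrix_mul
    continuous_subtype_val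

lemma continuous_rotate_apply {d : ℕ} (ρ : Matrix (Fin d) (Fin d) ℂ) (k l : Fin d) :
    Continuous fun U => rotate ρ U k l :=
  (continuous_rotate ρ).matrix_elem k l

lemma rotate_mul {d : ℕ} (ρ : Matrix (Fin d) (Fin d) ℂ) (U V : Matrix.unitaryGroup (Fin d) ℂ) :
    rotate ρ (U * V) = rotate (rotate ρ U) V := by
  simp [rotate, Matrix.conjTranspose_mul, Matrix.mul_assoc]

lemma rotate_isHermitian {d : ℕ} {ρ : Matrix (Fin d) (Fin d) ℂ} (hρ : ρ.IsHermitian)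
    (U : Matrix.unitaryGroup (Fin d) ℂ) : (rotate ρ U).IsHermitian :=
  Matrix.isHermitian_conjTranspose_mul_mul _ hρ

lemma rotate_trace {d : ℕ} (ρ : Matrix (Fin d) (Fin d) ℂ) (U : Matrix.unitaryGroup (Fin d) ℂ) :
    (rotate ρ U).trace = ρ.trace := by
  have h : (U : Matrix (Fin d) (Fin d) ℂ) * (U : Matrix (Fin d) (Fin d) ℂ).conjTranspose = 1 :=
    Matrix.mem_unitaryGroup_iff.mp U.2
  rw [rotate, Matrix.trace_mul_comm, ← Matrix.mul_assoc, h, Matrix.one_mul]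

lemma rotate_mul_rotate {d : ℕ} (ρ σ : Matrix (Fin d) (Fin d) ℂ)
    (U : Matrix.unitaryGroup (Fin d) ℂ) : rotate ρ U * rotate σ U = rotate (ρ * σ) U := by
  have h : (U : Matrix (Fin d) (Fin d) ℂ) * (U : Matrix (Fin d) (Fin d) ℂ).conjTranspose = 1 :=
    Matrix.mem_unitaryGroup_iff.mp U.2
  simp only [rotate, Matrix.mul_assoc]
  rw [← Matrix.mul_assoc (U : Matrix (Fin d) (Fin d) ℂ) (Matrix.conjTranspose _), h, Matrix.one_mul]

lemma trace_mul_self_re_eq_sum_normSq {d : ℕ} {A : Matrix (Fin d) (Fin d) ℂ}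
    (hA : A.IsHermitian) : (A * A).trace.re = ∑ k, ∑ l, Complex.normSq (A k l) := by
  simp only [Matrix.trace, Matrix.diag, Matrix.mul_apply, Complex.re_sum]
  refine Finset.sum_congr rfl fun k _ => Finset.sum_congr rfl fun l _ => ?_
  rw [← hA.apply l k, ← Complex.normSq_conj, Complex.normSq_apply]
  simp [← hA.apply k l]

/-- The permutation matrix sending `e_k` to `e_{σ k}`. -/
def permUnitary {d : ℕ} (σ : Equiv.Perm (Fin d)) : Matrix.unitaryGroup (Fin d) ℂ :=
  ⟨(1 : Matrix (Fin d) (Fin d) ℂ).submatrix id σ, by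
    rw [Matrix.mem_unitaryGroup_iff']
    ext i j
    simp [Matrix.mul_apply, Matrix.star_apply, Matrix.one_apply, eq_comm]⟩

lemma rotate_permUnitary {d : ℕ} (ρ : Matrix (Fin d) (Fin d) ℂ) (σ : Equiv.Perm (Fin d))
    (k l : Fin d) : rotate ρ (permUnitary σ) k l = ρ (σ k) (σ l) := by
  simp [rotate, permUnitary, Matrix.mul_apply, Matrix.one_apply]

/-- The projection onto `(e_p + w e_q)/√2`. -/
def pairProjection {d : ℕ} (p q : Fin d) (w : ℂ) : Matrix (Fin d) (Fin d) ℂ :=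
  (1 / 2 : ℂ) • (Matrix.single p p 1 + Matrix.single q q 1 + Matrix.single q p w +
    Matrix.single p q (star w))

lemma pairProjection_mul_self {d : ℕ} {p q : Fin d} (hpq : p ≠ q) {w : ℂ} (hw : star w * w = 1) :
    pairProjection p q w * pairProjection p q w = pairProjection p q w := by
  have hw' : w * star w = 1 := by rw [mul_comm, hw]
  simp only [pairProjection, smul_mul_smul_comm, add_mul, mul_add, Matrix.single_mul_single_same,
    Matrix.single_mul_single_of_ne _ _ _ _ hpq, Matrix.single_mul_single_of_ne _ _ _ _ hpq.symm,
    hw, hw', one_mul, mul_one, add_zero, zero_add]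
  module

lemma star_pairProjection {d : ℕ} (p q : Fin d) (w : ℂ) :
    star (pairProjection p q w) = pairProjection p q w := by
  rw [Matrix.star_eq_conjTranspose, pairProjection, Matrix.conjTranspose_smul]
  simp only [Matrix.conjTranspose_add, Matrix.conjTranspose_single, star_one, star_star]
  simp
  abel

/-- The unitary `1 + (i - 1) P` with `P` the projection onto `(e_p + w e_q)/√2`. -/
def pairUnitary {d : ℕ} {p q : Fin d} (hpq : p ≠ q) {w : ℂ} (hw : star w * w = 1) :
    Matrix.unitaryGroup (Fin d) ℂ :=
  ⟨1 + (Complex.I - 1) • pairProjection p q w, by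
    rw [Matrix.mem_unitaryGroup_iff, star_add, star_smul, star_pairProjection, star_one, add_mul,
      mul_add, mul_add, smul_mul_smul_comm, pairProjection_mul_self hpq hw, one_mul, mul_one,
      one_mul]
    have : (Complex.I - 1) * star (Complex.I - 1) = 2 := by
      simp only [star_sub, star_one, Complex.star_def, Complex.conj_I]
      linear_combination -Complex.I_sq
    rw [this]
    have h2 : star (Complex.I - 1) = -Complex.I - 1 := by
      simp
    rw [h2]
    module⟩

lemma rotate_pairUnitary {d : ℕ} {p q : Fin d} (hpq : p ≠ q) {w : ℂ} (hw : star w * w = 1)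
    {A : Matrix (Fin d) (Fin d) ℂ} (hA : A.IsHermitian) :
    (rotate A (pairUnitary hpq hw) p p).re =
      ((A p p).re + (A q q).re + 2 * (Complex.I * w * A p q).re) / 2 := by
  have hVp : (pairUnitary hpq hw : Matrix (Fin d) (Fin d) ℂ) p p = (1 + Complex.I) / 2 := by
    simp [pairUnitary, pairProjection, Matrix.single, hpq.symm]
    ring
  have hVq : (pairUnitary hpq hw : Matrix (Fin d) (Fin d) ℂ) q p = (Complex.I - 1) / 2 * w := by
    simp [pairUnitary, pairProjection, Matrix.single, hpq, hpq.symm]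
    ring
  have hV0 : ∀ i, i ≠ p ∧ i ≠ q →
      (pairUnitary hpq hw : Matrix (Fin d) (Fin d) ℂ) i p = 0 := by
    rintro i ⟨h1, h2⟩
    simp [pairUnitary, pairProjection, Matrix.single, h1, h1.symm, h2.symm]
  have hqp : A q p = star (A p q) := (hA.apply q p).symm
  have hw2 : w.re * w.re + w.im * w.im = 1 := by
    have := congrArg Complex.re hw
    simpa using this
  rw [rotate, Matrix.mul_apply, Fintype.sum_eq_add p q hpq
    (fun i hi => by rw [hV0 i hi, mul_zero]), Matrix.mul_apply, Matrix.mul_apply,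
    Fintype.sum_eq_add p q hpq (fun i hi => by
      rw [Matrix.conjTranspose_apply, hV0 i hi, star_zero, zero_mul]),
    Fintype.sum_eq_add p q hpq (fun i hi => by
      rw [Matrix.conjTranspose_apply, hV0 i hi, star_zero, zero_mul])]
  simp only [Matrix.conjTranspose_apply, hVp, hVq, hqp]
  have hp0 : (A p p).im = 0 := by
    have := congrArg Complex.im (hA.apply p p)
    simp at this; linarith
  have hq0 : (A q q).im = 0 := by
    have := congrArg Complex.im (hA.apply q q)
    simp at this; linarith
  simp [hp0, hq0]
  ring_nf
  linear_combination (A q q).re / 2 * hw2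

/-- Equivariance of a two-index function of a unitary under permutations of the columns. -/
def PermCovariant {d : ℕ} (W : Matrix.unitaryGroup (Fin d) ℂ → Fin d → Fin d → ℝ) : Prop :=
  ∀ U σ k l, W (U * permUnitary σ) k l = W U (σ k) (σ l)

/-! ### Haar second moments from symmetry. -/

lemma PermCovariant.integral_apply {d : ℕ}
    {W : Matrix.unitaryGroup (Fin d) ℂ → Fin d → Fin d → ℝ} (hW : PermCovariant W)
    (σ : Equiv.Perm (Fin d)) (k l : Fin d) :
    ∫ U, W U (σ k) (σ l) ∂(haarUnitary d) = ∫ U, W U k l ∂(haarUnitary d) := by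
  rw [← integral_mul_right_eq_self (fun U => W U k l) (permUnitary σ)]
  simp only [hW _ σ]

lemma PermCovariant.integral_diag {d : ℕ}
    {W : Matrix.unitaryGroup (Fin d) ℂ → Fin d → Fin d → ℝ} (hW : PermCovariant W) (k p : Fin d) :
    ∫ U, W U k k ∂(haarUnitary d) = ∫ U, W U p p ∂(haarUnitary d) := by
  simpa using hW.integral_apply (Equiv.swap p k) p p

lemma PermCovariant.integral_off_diag {d : ℕ}
    {W : Matrix.unitaryGroup (Fin d) ℂ → Fin d → Fin d → ℝ} (hW : PermCovariant W)
    {k l p q : Fin d} (hkl : k ≠ l) (hpq : p ≠ q) :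
    ∫ U, W U k l ∂(haarUnitary d) = ∫ U, W U p q ∂(haarUnitary d) := by
  -- Double transitivity: the first swap sends p to k, and the second sends the image of q to l
  -- while fixing k.
  have h := hW.integral_apply (Equiv.swap (Equiv.swap p k q) l * Equiv.swap p k) p q
  have hk : k ≠ Equiv.swap p k q := by
    intro h
    have h2 : Equiv.swap p k p = Equiv.swap p k q := by rw [Equiv.swap_apply_left]; exact h
    exact hpq ((Equiv.swap p k).injective h2)
  simpa [Equiv.swap_apply_of_ne_of_ne hk hkl] using h

lemma PermCovariant.sum_mul_integral {d : ℕ}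
    {W : Matrix.unitaryGroup (Fin d) ℂ → Fin d → Fin d → ℝ} (hW : PermCovariant W)
    {p q : Fin d} (hpq : p ≠ q) {C : Fin d → Fin d → ℝ} (hC : ∀ k, C k k = 1) :
    ∑ k, ∑ l, C k l * ∫ U, W U k l ∂(haarUnitary d) =
      d * (∫ U, W U p p ∂(haarUnitary d)) +
        (∑ k, ∑ l ∈ ({k}ᶜ : Finset (Fin d)), C k l) * ∫ U, W U p q ∂(haarUnitary d) := by
  have h : ∀ k, ∑ l, C k l * ∫ U, W U k l ∂(haarUnitary d) =
      (∫ U, W U p p ∂(haarUnitary d)) +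
        (∑ l ∈ ({k}ᶜ : Finset (Fin d)), C k l) * ∫ U, W U p q ∂(haarUnitary d) := by
    intro k
    rw [Fintype.sum_eq_add_sum_compl k, hC, one_mul, hW.integral_diag k p, Finset.sum_mul]
    congr 1
    refine Finset.sum_congr rfl fun l hl => ?_
    rw [hW.integral_off_diag (Ne.symm (by simpa using hl)) hpq]
  simp only [h, Finset.sum_add_distrib, Finset.sum_const, Finset.card_univ, Fintype.card_fin,
    nsmul_eq_mul, Finset.sum_mul]

lemma PermCovariant.sum_integral {d : ℕ}
    {W : Matrix.unitaryGroup (Fin d) ℂ → Fin d → Fin d → ℝ} (hW : PermCovariant W)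
    {p q : Fin d} (hpq : p ≠ q) :
    ∑ k, ∑ l, ∫ U, W U k l ∂(haarUnitary d) =
      d * (∫ U, W U p p ∂(haarUnitary d)) +
        d * (d - 1) * ∫ U, W U p q ∂(haarUnitary d) := by
  have h := hW.sum_mul_integral hpq (C := fun _ _ => 1) (fun _ => rfl)
  have hd : 1 ≤ d := by have := p.pos; omega
  have h2 : ∑ k : Fin d, ∑ _l ∈ ({k}ᶜ : Finset (Fin d)), (1 : ℝ) = d * (d - 1) := by
    simp [Finset.card_compl, Nat.cast_sub hd]
    ring
  simpa only [one_mul, h2] using h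

/-- The products of diagonal entries of `U† ρ U`. -/
def diagProduct {d : ℕ} (ρ : Matrix (Fin d) (Fin d) ℂ) (U : Matrix.unitaryGroup (Fin d) ℂ)
    (k l : Fin d) : ℝ :=
  (rotate ρ U k k).re * (rotate ρ U l l).re

/-- The squared moduli of the entries of `U† ρ U`. -/
def entryNormSq {d : ℕ} (ρ : Matrix (Fin d) (Fin d) ℂ) (U : Matrix.unitaryGroup (Fin d) ℂ)
    (k l : Fin d) : ℝ :=
  Complex.normSq (rotate ρ U k l)

lemma permCovariant_diagProduct {d : ℕ} (ρ : Matrix (Fin d) (Fin d) ℂ) :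
    PermCovariant (diagProduct ρ) := fun U σ k l => by
  simp only [diagProduct, rotate_mul, rotate_permUnitary]

lemma permCovariant_entryNormSq {d : ℕ} (ρ : Matrix (Fin d) (Fin d) ℂ) :
    PermCovariant (entryNormSq ρ) := fun U σ k l => by
  simp only [entryNormSq, rotate_mul, rotate_permUnitary]

lemma continuous_diagProduct {d : ℕ} (ρ : Matrix (Fin d) (Fin d) ℂ) (k l : Fin d) :
    Continuous fun U => diagProduct ρ U k l :=
  (Complex.continuous_re.comp (continuous_rotate_apply ρ k k)).mul
    (Complex.continuous_re.comp (continuous_rotate_apply ρ l l))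

lemma continuous_entryNormSq {d : ℕ} (ρ : Matrix (Fin d) (Fin d) ℂ) (k l : Fin d) :
    Continuous fun U => entryNormSq ρ U k l :=
  Complex.continuous_normSq.comp (continuous_rotate_apply ρ k l)

lemma diag_im_eq_zero {d : ℕ} {A : Matrix (Fin d) (Fin d) ℂ} (hA : A.IsHermitian) (k : Fin d) :
    (A k k).im = 0 := by
  have := congrArg Complex.im (hA.apply k k)
  simp at this; linarith

lemma entryNormSq_diag {d : ℕ} {ρ : Matrix (Fin d) (Fin d) ℂ} (hρ : ρ.IsHermitian)
    (U : Matrix.unitaryGroup (Fin d) ℂ) (k : Fin d) :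
    entryNormSq ρ U k k = diagProduct ρ U k k := by
  simp [entryNormSq, diagProduct, Complex.normSq_apply, diag_im_eq_zero (rotate_isHermitian hρ U) k]

/-- With A = U†ρU, each `pairUnitary` turns A_pp into (A_pp + A_qq + 2 Re(iwA_pq))/2. Squaring and
summing over w = 1, -1, i, -i cancels the cross terms and leaves (A_pp + A_qq)² + 2|A_pq|². By right
invariance the average reads 4α = 2α + 2β + 2γ. -/
lemma integral_diagProduct_diag_eq {d : ℕ} {ρ : Matrix (Fin d) (Fin d) ℂ} (hρ : ρ.IsHermitian)
    {p q : Fin d} (hpq : p ≠ q) :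
    ∫ U, diagProduct ρ U p p ∂(haarUnitary d) =
      (∫ U, diagProduct ρ U p q ∂(haarUnitary d)) + ∫ U, entryNormSq ρ U p q ∂(haarUnitary d) := by
  have hI : ∀ k l, Integrable (fun U => diagProduct ρ U k l) (haarUnitary d) := fun k l =>
    integrable_haarUnitary_of_continuous (continuous_diagProduct ρ k l)
  have hE : Integrable (fun U => entryNormSq ρ U p q) (haarUnitary d) :=
    integrable_haarUnitary_of_continuous (continuous_entryNormSq ρ p q)
  have hV : ∀ V, Integrable (fun U => diagProduct ρ (U * V) p p) (haarUnitary d) := fun V =>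
    integrable_haarUnitary_of_continuous
      ((continuous_diagProduct ρ p p).comp (continuous_mul_const V))
  have hinv : ∀ V, ∫ U, diagProduct ρ (U * V) p p ∂(haarUnitary d) =
      ∫ U, diagProduct ρ U p p ∂(haarUnitary d) := fun V =>
    integral_mul_right_eq_self (fun U => diagProduct ρ U p p) V
  have w1 : star (1 : ℂ) * 1 = 1 := by simp
  have w2 : star (-1 : ℂ) * -1 = 1 := by simp
  have w3 : star Complex.I * Complex.I = 1 := by simp
  have w4 : star (-Complex.I) * -Complex.I = 1 := by simp
  have hpt : ∀ U, diagProduct ρ (U * pairUnitary hpq w1) p p +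
      diagProduct ρ (U * pairUnitary hpq w2) p p + (diagProduct ρ (U * pairUnitary hpq w3) p p +
      diagProduct ρ (U * pairUnitary hpq w4) p p) =
      diagProduct ρ U p p + diagProduct ρ U q q +
        (2 * diagProduct ρ U p q + 2 * entryNormSq ρ U p q) := by
    intro U
    have hA := rotate_isHermitian hρ U
    simp only [diagProduct, rotate_mul, rotate_pairUnitary hpq _ hA, entryNormSq,
      Complex.normSq_apply]
    simp
    ring
  have h := integral_congr_ae (μ := haarUnitary d) (Filter.Eventually.of_forall hpt)
  have hVV : ∀ V V', Integrable
      (fun U => diagProduct ρ (U * V) p p + diagProduct ρ (U * V') p p) (haarUnitary d) :=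
    fun V V' => (hV V).add (hV V')
  have hII : Integrable (fun U => diagProduct ρ U p p + diagProduct ρ U q q) (haarUnitary d) :=
    (hI p p).add (hI q q)
  have hIE : Integrable (fun U => 2 * diagProduct ρ U p q + 2 * entryNormSq ρ U p q)
      (haarUnitary d) := ((hI p q).const_mul 2).add (hE.const_mul 2)
  rw [integral_add (hVV _ _) (hVV _ _), integral_add (hV _) (hV _),
    integral_add (hV _) (hV _), integral_add hII hIE, integral_add (hI _ _) (hI _ _),
    integral_add ((hI _ _).const_mul 2) (hE.const_mul 2), integral_const_mul,
    integral_const_mul, hinv, hinv, hinv, hinv,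
    (permCovariant_diagProduct ρ).integral_diag q p] at h
  linarith

lemma sum_diagProduct {d : ℕ} (ρ : Matrix (Fin d) (Fin d) ℂ)
    (U : Matrix.unitaryGroup (Fin d) ℂ) :
    ∑ k, ∑ l, diagProduct ρ U k l = ρ.trace.re ^ 2 := by
  simp only [diagProduct, ← Finset.sum_mul_sum]
  rw [← rotate_trace ρ U, Matrix.trace, Complex.re_sum, sq]
  rfl

lemma sum_entryNormSq {d : ℕ} {ρ : Matrix (Fin d) (Fin d) ℂ} (hρ : ρ.IsHermitian)
    (U : Matrix.unitaryGroup (Fin d) ℂ) :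
    ∑ k, ∑ l, entryNormSq ρ U k l = purity ρ := by
  simp only [entryNormSq]
  rw [← trace_mul_self_re_eq_sum_normSq (rotate_isHermitian hρ U), rotate_mul_rotate,
    rotate_trace, purity]

lemma sum_integral_haarUnitary_of_const {d : ℕ}
    {W : Matrix.unitaryGroup (Fin d) ℂ → Fin d → Fin d → ℝ}
    (hW : ∀ k l, Continuous fun U => W U k l) {c : ℝ} (h : ∀ U, ∑ k, ∑ l, W U k l = c) :
    ∑ k, ∑ l, ∫ U, W U k l ∂(haarUnitary d) = c := by
  have hI : ∀ k l, Integrable (fun U => W U k l) (haarUnitary d) := fun k l =>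
    integrable_haarUnitary_of_continuous (hW k l)
  calc _ = ∑ k, ∫ U, ∑ l, W U k l ∂(haarUnitary d) :=
        Finset.sum_congr rfl fun k _ => (integral_finsetSum _ fun l _ => hI k l).symm
    _ = ∫ U, ∑ k, ∑ l, W U k l ∂(haarUnitary d) :=
        (integral_finsetSum _ fun k _ => integrable_finsetSum _ fun l _ => hI k l).symm
    _ = c := by simp [h]

lemma IsDensityMatrix.isHermitian {d : ℕ} {ρ : Matrix (Fin d) (Fin d) ℂ}
    (hρ : IsDensityMatrix ρ) : ρ.IsHermitian :=
  hρ.posSemidef.1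

/-- Second moments of the entries of `U† ρ U` for Haar distributed `U`. -/
lemma haarUnitary_second_moments {d : ℕ} {ρ : Matrix (Fin d) (Fin d) ℂ}
    (hρ : IsDensityMatrix ρ) {p q : Fin d} (hpq : p ≠ q) :
    d * (∫ U, diagProduct ρ U p p ∂(haarUnitary d)) = (1 + purity ρ) / (d + 1) ∧
    ∫ U, diagProduct ρ U p q ∂(haarUnitary d) = (d - purity ρ) / (d * (d ^ 2 - 1)) ∧
    ∫ U, entryNormSq ρ U p q ∂(haarUnitary d) = (d * purity ρ - 1) / (d * (d ^ 2 - 1)) := by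
  have hd : 2 ≤ d := by
    have h1 := p.2
    have h2 := q.2
    have h3 : (p : ℕ) ≠ q := fun h => hpq (Fin.ext h)
    omega
  have hH := hρ.isHermitian
  have h1 := integral_diagProduct_diag_eq hH hpq
  have h2 := (permCovariant_diagProduct ρ).sum_integral hpq
  rw [sum_integral_haarUnitary_of_const (continuous_diagProduct ρ) (sum_diagProduct ρ),
    hρ.trace_eq_one, Complex.one_re, one_pow] at h2
  have h3 := (permCovariant_entryNormSq ρ).sum_integral hpq
  rw [sum_integral_haarUnitary_of_const (continuous_entryNormSq ρ) (sum_entryNormSq hH)] at h3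
  simp only [entryNormSq_diag hH] at h3
  -- What remains is linear algebra: α = β + γ, dα + d(d-1)β = 1 and dα + d(d-1)γ = tr ρ².
  generalize (∫ U, diagProduct ρ U p p ∂(haarUnitary d)) = α at *
  generalize (∫ U, diagProduct ρ U p q ∂(haarUnitary d)) = β at *
  generalize (∫ U, entryNormSq ρ U p q ∂(haarUnitary d)) = γ at *
  have hdR : (2 : ℝ) ≤ d := by exact_mod_cast hd
  have hd0 : (d : ℝ) ≠ 0 := by positivity
  have hd1 : (d : ℝ) + 1 ≠ 0 := by positivity
  have hd2 : (d : ℝ) ^ 2 - 1 ≠ 0 := by nlinarith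
  refine ⟨?_, ?_, ?_⟩
  · rw [eq_div_iff hd1]
    linear_combination -h2 - h3 + (d : ℝ) * (d - 1) * h1
  · rw [eq_div_iff (mul_ne_zero hd0 hd2)]
    linear_combination -d * h2 + h3 - (d : ℝ) * (d - 1) * h1
  · rw [eq_div_iff (mul_ne_zero hd0 hd2)]
    linear_combination h2 - d * h3 - (d : ℝ) * (d - 1) * h1

-- The eigenvalues are nonnegative with sum 1, so their squares sum to at most 1. This lets √((1 -
-- tr ρ²)²) simplify without an absolute value.
open scoped ComplexOrder in
lemma purity_le_one {d : ℕ} {ρ : Matrix (Fin d) (Fin d) ℂ} (hρ : IsDensityMatrix ρ) :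
    purity ρ ≤ 1 := by
  have hH := hρ.isHermitian
  have hdiag : rotate ρ hH.eigenvectorUnitary =
      Matrix.diagonal (fun i => (hH.eigenvalues i : ℂ)) := by
    have h := hH.conjStarAlgAut_star_eigenvectorUnitary
    rw [Unitary.conjStarAlgAut_apply, Unitary.coe_star, star_star] at h
    exact h
  have h1 : ∑ i, hH.eigenvalues i = 1 := by
    have h := congrArg Complex.re (rotate_trace ρ hH.eigenvectorUnitary)
    rw [hdiag, hρ.trace_eq_one, Matrix.trace_diagonal, Complex.re_sum] at h
    simpa using h
  have h2 : purity ρ = ∑ i, hH.eigenvalues i ^ 2 := by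
    rw [purity, ← rotate_trace (ρ * ρ) hH.eigenvectorUnitary, ← rotate_mul_rotate, hdiag,
      Matrix.diagonal_mul_diagonal, Matrix.trace_diagonal, Complex.re_sum]
    simp [sq]
  have h3 : ∀ i, 0 ≤ hH.eigenvalues i := hρ.posSemidef.eigenvalues_nonneg
  rw [h2, ← one_pow 2, ← h1]
  exact Finset.sum_sq_le_sq_sum_of_nonneg fun i _ => h3 i

/-! ### Functions of the random matrix -/

open scoped Matrix.Norms.Operator in
lemma continuous_exp_smul {d : ℕ} (z : ℂ) :
    Continuous fun B : Matrix (Fin d) (Fin d) ℂ => NormedSpace.exp (z • B) :=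
  NormedSpace.exp_continuous.comp (continuous_const_smul z)

lemma exp_smul_conjDiagonal {d : ℕ} (z : ℂ) (l : Fin d → ℝ) (U : Matrix.unitaryGroup (Fin d) ℂ) :
    NormedSpace.exp (z • conjDiagonal (l, U)) =
      (U : Matrix (Fin d) (Fin d) ℂ) * Matrix.diagonal (fun i => Complex.exp (z * l i)) *
        (U : Matrix (Fin d) (Fin d) ℂ).conjTranspose := by
  have h : (U : Matrix (Fin d) (Fin d) ℂ) * (U : Matrix (Fin d) (Fin d) ℂ).conjTranspose = 1 :=
    Matrix.mem_unitaryGroup_iff.mp U.2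
  have h1 : (U : Matrix (Fin d) (Fin d) ℂ)⁻¹ = (U : Matrix (Fin d) (Fin d) ℂ).conjTranspose :=
    Matrix.inv_eq_right_inv h
  have hu : IsUnit (U : Matrix (Fin d) (Fin d) ℂ) := IsUnit.of_mul_eq_one _ h
  have h2 : z • conjDiagonal (l, U) = (U : Matrix (Fin d) (Fin d) ℂ) *
      Matrix.diagonal (fun i => z * (l i : ℂ)) * (U : Matrix (Fin d) (Fin d) ℂ)⁻¹ := by
    rw [h1, conjDiagonal, ← Matrix.smul_mul, ← Matrix.mul_smul, ← Matrix.diagonal_smul]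
    rfl
  rw [h2, Matrix.exp_conj _ _ hu, Matrix.exp_diagonal, h1]
  congr 3
  ext i
  rw [Pi.coe_exp, Complex.exp_eq_exp_ℂ]

lemma measurable_conjDiagonal (d : ℕ) :
    Measurable (conjDiagonal : (Fin d → ℝ) × Matrix.unitaryGroup (Fin d) ℂ → _) := by
  refine Continuous.measurable ?_
  unfold conjDiagonal
  have hU : Continuous fun x : (Fin d → ℝ) × Matrix.unitaryGroup (Fin d) ℂ =>
      (x.2 : Matrix (Fin d) (Fin d) ℂ) := continuous_subtype_val.comp continuous_snd
  refine (hU.matrix_mul (Continuous.matrix_diagonal ?_)).matrix_mul hU.matrix_conjTranspose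
  fun_prop

lemma continuous_decoherenceFactor {d : ℕ} (ρ₀ : Matrix (Fin d) (Fin d) ℂ) (a a' t : ℝ) :
    Continuous fun B => decoherenceFactor B ρ₀ a a' t := by
  unfold decoherenceFactor
  exact ((((continuous_exp_smul _).matrix_mul continuous_const).matrix_trace).norm).pow 2

lemma continuous_evolvedState {d : ℕ} (ρ₀ : Matrix (Fin d) (Fin d) ℂ) (a t : ℝ) :
    Continuous fun B => evolvedState B ρ₀ a t := by
  unfold evolvedState
  exact ((continuous_exp_smul _).matrix_mul continuous_const).matrix_mul (continuous_exp_smul _)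

lemma continuous_superFidelityFactor {d : ℕ} (ρ₀ : Matrix (Fin d) (Fin d) ℂ) (a a' t : ℝ) :
    Continuous fun B => superFidelityFactor B ρ₀ a a' t := by
  have h := fun a => continuous_evolvedState ρ₀ a t
  have hp : ∀ a, Continuous fun B => purity (evolvedState B ρ₀ a t) := fun a =>
    Complex.continuous_re.comp ((h a).matrix_mul (h a)).matrix_trace
  unfold superFidelityFactor superFidelity
  exact (Complex.continuous_re.comp ((h a).matrix_mul (h a')).matrix_trace).add
    (((continuous_const.sub (hp a)).mul (continuous_const.sub (hp a'))).sqrt)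

/-- The trace is Σ_k e^{-iθ_k} r_k, with r_k real because U†ρ₀U is Hermitian; its squared modulus is
the double sum of r_m r_n cos(θ_m - θ_n). -/
lemma decoherenceFactor_conjDiagonal {d : ℕ} {ρ₀ : Matrix (Fin d) (Fin d) ℂ}
    (hρ₀ : ρ₀.IsHermitian) (a a' t : ℝ) (l : Fin d → ℝ) (U : Matrix.unitaryGroup (Fin d) ℂ) :
    decoherenceFactor (conjDiagonal (l, U)) ρ₀ a a' t =
      ∑ m, ∑ n, Real.cos ((a - a') * (l n - l m) * t) * diagProduct ρ₀ U m n := by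
  have h1 : (NormedSpace.exp ((-(Complex.I * (((a - a') * t : ℝ) : ℂ))) • conjDiagonal (l, U)) *
      ρ₀).trace = ∑ k, Complex.exp (((-((a - a') * t * l k) : ℝ) : ℂ) * Complex.I) *
        ((rotate ρ₀ U k k).re : ℂ) := by
    rw [exp_smul_conjDiagonal, Matrix.mul_assoc, Matrix.mul_assoc, Matrix.trace_mul_comm,
      Matrix.mul_assoc]
    change (Matrix.diagonal _ * rotate ρ₀ U).trace = _
    rw [Matrix.trace]
    refine Finset.sum_congr rfl fun k _ => ?_
    rw [Matrix.diag_apply, Matrix.diagonal_mul]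
    congr 1
    · congr 1; push_cast; ring
    · exact Complex.ext rfl (by
        rw [diag_im_eq_zero (rotate_isHermitian hρ₀ U), Complex.ofReal_im])
  have h2 : ∀ x r : ℝ, (Complex.exp ((x : ℂ) * Complex.I) * (r : ℂ)).re = Real.cos x * r := by
    intro x r
    rw [Complex.re_mul_ofReal, Complex.exp_ofReal_mul_I_re]
  have h3 : ∀ x r : ℝ, (Complex.exp ((x : ℂ) * Complex.I) * (r : ℂ)).im = Real.sin x * r := by
    intro x r
    rw [Complex.im_mul_ofReal, Complex.exp_ofReal_mul_I_im]
  rw [decoherenceFactor, h1, Complex.sq_norm, Complex.normSq_apply, Complex.re_sum,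
    Complex.im_sum]
  simp only [h2, h3]
  rw [Finset.sum_mul_sum, Finset.sum_mul_sum, ← Finset.sum_add_distrib]
  refine Finset.sum_congr rfl fun m _ => ?_
  rw [← Finset.sum_add_distrib]
  refine Finset.sum_congr rfl fun n _ => ?_
  have h4 : (a - a') * (l n - l m) * t = -((a - a') * t * l m) - -((a - a') * t * l n) := by ring
  rw [h4, Real.cos_sub, diagProduct]
  ring

lemma rotate_evolvedState_conjDiagonal {d : ℕ} (ρ₀ : Matrix (Fin d) (Fin d) ℂ) (a t : ℝ)
    (l : Fin d → ℝ) (U : Matrix.unitaryGroup (Fin d) ℂ) (m n : Fin d) :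
    rotate (evolvedState (conjDiagonal (l, U)) ρ₀ a t) U m n =
      Complex.exp (((a * t * (l n - l m) : ℝ) : ℂ) * Complex.I) * rotate ρ₀ U m n := by
  have h : (U : Matrix (Fin d) (Fin d) ℂ).conjTranspose * (U : Matrix (Fin d) (Fin d) ℂ) = 1 :=
    Matrix.mem_unitaryGroup_iff'.mp U.2
  have h1 : rotate (evolvedState (conjDiagonal (l, U)) ρ₀ a t) U =
      Matrix.diagonal (fun i => Complex.exp (-(Complex.I * ((a * t : ℝ) : ℂ)) * l i)) *
        rotate ρ₀ U * Matrix.diagonal (fun i => Complex.exp (Complex.I * ((a * t : ℝ) : ℂ) * l i)) := by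
    rw [evolvedState, exp_smul_conjDiagonal, exp_smul_conjDiagonal]
    simp only [rotate, Matrix.mul_assoc]
    rw [h, ← Matrix.mul_assoc _ (U : Matrix (Fin d) (Fin d) ℂ), h, Matrix.one_mul, Matrix.mul_one]
  rw [h1, Matrix.mul_diagonal, Matrix.diagonal_mul, mul_right_comm, ← Complex.exp_add]
  congr 2
  push_cast; ring

/-- The phases of entry (m,n) of one state and entry (n,m) of the other combine to (a-a')(λ_n-λ_m)t.
Taking a = a' gives conservation of purity. -/
lemma trace_evolvedState_mul_evolvedState {d : ℕ} {ρ₀ : Matrix (Fin d) (Fin d) ℂ}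
    (hρ₀ : ρ₀.IsHermitian) (a a' t : ℝ) (l : Fin d → ℝ) (U : Matrix.unitaryGroup (Fin d) ℂ) :
    (evolvedState (conjDiagonal (l, U)) ρ₀ a t *
        evolvedState (conjDiagonal (l, U)) ρ₀ a' t).trace.re =
      ∑ m, ∑ n, Real.cos ((a - a') * (l n - l m) * t) * entryNormSq ρ₀ U m n := by
  rw [← rotate_trace _ U, ← rotate_mul_rotate, Matrix.trace, Complex.re_sum]
  refine Finset.sum_congr rfl fun m _ => ?_
  rw [Matrix.diag_apply, Matrix.mul_apply, Complex.re_sum]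
  refine Finset.sum_congr rfl fun n _ => ?_
  rw [rotate_evolvedState_conjDiagonal, rotate_evolvedState_conjDiagonal, mul_mul_mul_comm,
    ← Complex.exp_add, ← (rotate_isHermitian hρ₀ U).apply n m, Complex.star_def, Complex.mul_conj,
    Complex.re_mul_ofReal, entryNormSq, ← add_mul, ← Complex.ofReal_add,
    Complex.exp_ofReal_mul_I_re]
  congr 2
  ring

lemma purity_evolvedState_conjDiagonal {d : ℕ} {ρ₀ : Matrix (Fin d) (Fin d) ℂ}
    (hρ₀ : ρ₀.IsHermitian) (a t : ℝ) (l : Fin d → ℝ) (U : Matrix.unitaryGroup (Fin d) ℂ) :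
    purity (evolvedState (conjDiagonal (l, U)) ρ₀ a t) = purity ρ₀ := by
  rw [purity, trace_evolvedState_mul_evolvedState hρ₀, ← sum_entryNormSq hρ₀ U]
  simp

lemma superFidelityFactor_conjDiagonal {d : ℕ} {ρ₀ : Matrix (Fin d) (Fin d) ℂ}
    (hρ₀ : IsDensityMatrix ρ₀) (a a' t : ℝ) (l : Fin d → ℝ)
    (U : Matrix.unitaryGroup (Fin d) ℂ) :
    superFidelityFactor (conjDiagonal (l, U)) ρ₀ a a' t =
      (∑ m, ∑ n, Real.cos ((a - a') * (l n - l m) * t) * entryNormSq ρ₀ U m n) +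
        linearEntropy ρ₀ := by
  have hH := hρ₀.isHermitian
  rw [superFidelityFactor, superFidelity, trace_evolvedState_mul_evolvedState hH,
    purity_evolvedState_conjDiagonal hH, purity_evolvedState_conjDiagonal hH,
    Real.sqrt_mul_self (sub_nonneg.mpr (purity_le_one hρ₀)), linearEntropy]

/-! ### Joint averages over eigenvalues and eigenvectors. -/

lemma sum_cos_eq_two_mul_cosineSum {d : ℕ} (a a' t : ℝ) (l : Fin d → ℝ) :
    ∑ m, ∑ n ∈ ({m}ᶜ : Finset (Fin d)), Real.cos ((a - a') * (l n - l m) * t) =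
      2 * cosineSum a a' t l := by
  rw [← Finset.sum_sum_Ioi_add_eq_sum_sum_off_diag
    (fun n m => Real.cos ((a - a') * (l n - l m) * t)), cosineSum, Finset.mul_sum]
  refine Finset.sum_congr rfl fun m _ => ?_
  rw [Finset.mul_sum]
  refine Finset.sum_congr rfl fun n _ => ?_
  rw [two_mul, ← Real.cos_neg ((a - a') * (l m - l n) * t)]
  congr 2
  ring

/-- Averages of cosine sums weighted by a permutation covariant function of the unitary. -/
lemma integral_sum_cos_mul_permCovariant {d : ℕ} {η : ℝ} (hd : 2 ≤ d) (hη : 0 < η)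
    {W : Matrix.unitaryGroup (Fin d) ℂ → Fin d → Fin d → ℝ} (hW : PermCovariant W)
    (hWc : ∀ k l, Continuous fun U => W U k l) {p q : Fin d} (hpq : p ≠ q) (a a' t : ℝ) :
    Integrable (fun x : (Fin d → ℝ) × Matrix.unitaryGroup (Fin d) ℂ =>
        ∑ m, ∑ n, Real.cos ((a - a') * (x.1 n - x.1 m) * t) * W x.2 m n)
      ((gueEigenvalues d η).prod (haarUnitary d)) ∧
    ∫ x, ∑ m, ∑ n, Real.cos ((a - a') * (x.1 n - x.1 m) * t) * W x.2 m n
      ∂((gueEigenvalues d η).prod (haarUnitary d)) =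
      d * (∫ U, W U p p ∂(haarUnitary d)) +
        (∫ l, cosineSum a a' t l ∂(gueEigenvalues d η)) *
          (2 * ∫ U, W U p q ∂(haarUnitary d)) := by
  have hP := isProbabilityMeasure_gueEigenvalues hd hη
  have hcos : ∀ m n : Fin d, Integrable
      (fun l : Fin d → ℝ => Real.cos ((a - a') * (l n - l m) * t)) (gueEigenvalues d η) :=
    fun m n => Integrable.of_bound (Continuous.aestronglyMeasurable (by fun_prop)) 1
      (Filter.Eventually.of_forall fun l => Real.abs_cos_le_one _)
  have hint : ∀ m n : Fin d, Integrable
      (fun x : (Fin d → ℝ) × Matrix.unitaryGroup (Fin d) ℂ =>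
        Real.cos ((a - a') * (x.1 n - x.1 m) * t) * W x.2 m n)
      ((gueEigenvalues d η).prod (haarUnitary d)) := fun m n =>
    (hcos m n).mul_prod (integrable_haarUnitary_of_continuous (hWc m n))
  refine ⟨integrable_finsetSum _ fun m _ => integrable_finsetSum _ fun n _ => hint m n, ?_⟩
  rw [integral_finsetSum _ fun m _ => integrable_finsetSum _ fun n _ => hint m n]
  have h1 : ∀ m : Fin d, (∫ x, ∑ n, Real.cos ((a - a') * (x.1 n - x.1 m) * t) * W x.2 m n
      ∂((gueEigenvalues d η).prod (haarUnitary d))) =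
      ∑ n, (∫ l, Real.cos ((a - a') * (l n - l m) * t) ∂(gueEigenvalues d η)) *
        ∫ U, W U m n ∂(haarUnitary d) := by
    intro m
    rw [integral_finsetSum _ fun n _ => hint m n]
    exact Finset.sum_congr rfl fun n _ => integral_prod_mul
      (fun l : Fin d → ℝ => Real.cos ((a - a') * (l n - l m) * t)) (fun U => W U m n)
  simp only [h1]
  -- The diagonal coefficients are averages of cos 0 = 1 under a probability measure; the
  -- off-diagonal ones add up to twice the averaged cosine sum.
  rw [hW.sum_mul_integral hpq (C := fun m n =>
    ∫ l, Real.cos ((a - a') * (l n - l m) * t) ∂(gueEigenvalues d η)) (by intro k; simp)]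
  have h2 : (∑ m, ∑ n ∈ ({m}ᶜ : Finset (Fin d)),
      ∫ l, Real.cos ((a - a') * (l n - l m) * t) ∂(gueEigenvalues d η)) =
      2 * ∫ l, cosineSum a a' t l ∂(gueEigenvalues d η) := by
    rw [← integral_const_mul]
    simp only [← sum_cos_eq_two_mul_cosineSum]
    rw [integral_finsetSum _ fun m _ => integrable_finsetSum _ fun n _ => hcos m n]
    exact Finset.sum_congr rfl fun m _ => (integral_finsetSum _ fun n _ => hcos m n).symm
  rw [h2]
  ring

end

end VonNeumannGUE

/-! ### Assembly of the three averages. -/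

open VonNeumannGUE MeasureTheory in
theorem mainTheorem1 (d : ℕ) (hd : 2 ≤ d) (η : ℝ) (hη : 0 < η)
    (ρ₀ : Matrix (Fin d) (Fin d) ℂ) (hρ₀ : VonNeumannGUE.IsDensityMatrix ρ₀) (a a' t : ℝ) :
    (MeasureTheory.Integrable
        (fun B => VonNeumannGUE.decoherenceFactor B ρ₀ a a' t) (VonNeumannGUE.gueMeasure d η) ∧
      ∫ B, VonNeumannGUE.decoherenceFactor B ρ₀ a a' t ∂(VonNeumannGUE.gueMeasure d η) =
        (1 + VonNeumannGUE.purity ρ₀) / ((d : ℝ) + 1) +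
          (∫ l, VonNeumannGUE.cosineSum a a' t l ∂(VonNeumannGUE.gueEigenvalues d η)) *
            (2 * ((d : ℝ) - VonNeumannGUE.purity ρ₀) / ((d : ℝ) * ((d : ℝ) ^ 2 - 1)))) ∧
    (MeasureTheory.Integrable
        (fun B => VonNeumannGUE.superFidelityFactor B ρ₀ a a' t) (VonNeumannGUE.gueMeasure d η) ∧
      ∫ B, VonNeumannGUE.superFidelityFactor B ρ₀ a a' t ∂(VonNeumannGUE.gueMeasure d η) =
        VonNeumannGUE.linearEntropy ρ₀ + (1 + VonNeumannGUE.purity ρ₀) / ((d : ℝ) + 1) +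
          (∫ l, VonNeumannGUE.cosineSum a a' t l ∂(VonNeumannGUE.gueEigenvalues d η)) *
            (2 * ((d : ℝ) * VonNeumannGUE.purity ρ₀ - 1) / ((d : ℝ) * ((d : ℝ) ^ 2 - 1)))) ∧
    (MeasureTheory.Integrable
        (fun l : Fin d → ℝ => VonNeumannGUE.cosineSum a a' t l)
        (VonNeumannGUE.gueEigenvalues d η) ∧
      ∫ l, VonNeumannGUE.cosineSum a a' t l ∂(VonNeumannGUE.gueEigenvalues d η) =
        VonNeumannGUE.guePolynomial d ((a - a') * t / Real.sqrt η) *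
          Real.exp (-((a - a') * t / Real.sqrt η) ^ 2)) := by
  have hpq : (⟨0, by omega⟩ : Fin d) ≠ ⟨1, by omega⟩ := by simp
  obtain ⟨hα, hβ, hγ⟩ := haarUnitary_second_moments hρ₀ hpq
  have hH := hρ₀.isHermitian
  have := isProbabilityMeasure_gueEigenvalues hd hη
  have hm := (measurable_conjDiagonal d).aemeasurable
    (μ := (gueEigenvalues d η).prod (haarUnitary d))
  refine ⟨?_, ?_, integrable_cosineSum hd hη a a' t, integral_cosineSum hd hη a a' t⟩
  · obtain ⟨h1, h2⟩ := integral_sum_cos_mul_permCovariant hd hη (permCovariant_diagProduct ρ₀)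
      (continuous_diagProduct ρ₀) hpq a a' t
    simp only [← decoherenceFactor_conjDiagonal hH] at h1 h2
    have hc := (continuous_decoherenceFactor ρ₀ a a' t).aestronglyMeasurable
      (μ := gueMeasure d η)
    refine ⟨(integrable_map_measure hc hm).mpr h1, ?_⟩
    rw [gueMeasure, integral_map hm hc, h2, hα, hβ, mul_div_assoc]
  · obtain ⟨h1, h2⟩ := integral_sum_cos_mul_permCovariant hd hη (permCovariant_entryNormSq ρ₀)
      (continuous_entryNormSq ρ₀) hpq a a' t
    have h3 := h1.add (integrable_const (linearEntropy ρ₀))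
    have h4 : ∀ x : (Fin d → ℝ) × Matrix.unitaryGroup (Fin d) ℂ,
        superFidelityFactor (conjDiagonal x) ρ₀ a a' t =
        (∑ m, ∑ n, Real.cos ((a - a') * (x.1 n - x.1 m) * t) * entryNormSq ρ₀ x.2 m n) +
          linearEntropy ρ₀ := fun x => superFidelityFactor_conjDiagonal hρ₀ a a' t x.1 x.2
    have hc := (continuous_superFidelityFactor ρ₀ a a' t).aestronglyMeasurable
      (μ := gueMeasure d η)
    refine ⟨(integrable_map_measure hc hm).mpr
      (h3.congr (Filter.Eventually.of_forall fun x => (h4 x).symm)), ?_⟩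
    rw [gueMeasure, integral_map hm hc]
    simp only [h4]
    rw [integral_add h1 (integrable_const _), h2, integral_const, probReal_univ, one_smul]
    -- On the diagonal |R_pp|² = R_pp², so both factors share the same diagonal moment `hα`.
    simp only [entryNormSq_diag hH]
    rw [hα, hγ]
    ring
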